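/- Let the scalar field be $\mathbb{R}$ or $\mathbb{C}$, let $L(X)$ denote the Banach algebra of bounded linear operators on a Banach space $X$, and let "closed ideal" mean two-sided ideal that is closed in the operator norm. For $2<r<\infty$ call a sequence $u=(u_j)_{j\ge 1}$ of positive reals admissible for $r$ if $\sum_{j:\,u_j<\varepsilon}u_j^{2r/(r-2)}=\infty$ for every $\varepsilon>0$, and let $\mathfrak{X}_{r,u}$ be the Banach space of all scalar sequences $(a_j)$ for which the norm $$\|(a_j)\|=\max\Big\{\Big(\sum_j|a_j|^r\Big)^{1/r},\Big(\sum_j|a_ju_j|^2\Big)^{1/2}\Big\}$$ is finite. Rosenthal's space $\mathfrak{X}_p$ is any of the spaces $\mathfrak{X}_{p,u}$ with $u$ admissible for $p$ if $2<p<\infty$, and any of the dual spaces $\mathfrak{X}_{q,u}^*$ with $\frac1p+\frac1q=1$ and $u$ admissible for $q$ if $1<p<2$. Theorem. Let $1<p<\infty$ with $p\neq 2$. Each of the algebras $L(\mathfrak{X}_p)$ and $L(L_p(0,1))$ has exactly $2^{2^{\aleph_0}}$ distinct closed ideals. Moreover, each of these algebras contains an antichain of closed ideals (with respect to inclusion)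 of cardinality $2^{2^{\aleph_0}}$ and a chain of closed ideals of cardinality $2^{\aleph_0}$. -/

import Mathlib

open scoped ENNReal
open MeasureTheory

/-- The set of closed two-sided ideals of a normed ring `A`.  When `A` is a unital normed algebra,
for instance the algebra of bounded operators on a normed space, a two-sided ideal of the ring `A`
is automatically a linear subspace, because `c • a = (c • 1) * a`. -/
def closedIdeals (A : Type*) [NormedRing A] : Set (TwoSidedIdeal A) :=
  {I | IsClosed (I : Set A)}

/-- The Banach algebra `L(X)` of bounded operators on `X` has exactly `2 ^ 2 ^ ℵ₀` closed two-sided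
ideals; moreover there are an antichain of `2 ^ 2 ^ ℵ₀` closed ideals and a chain of `2 ^ ℵ₀` closed
ideals, with respect to inclusion. -/
def HasManyClosedIdeals (𝕜 X : Type*) [RCLike 𝕜] [NormedAddCommGroup X] [NormedSpace 𝕜 X] : Prop :=
  Cardinal.mk (closedIdeals (X →L[𝕜] X)) = 2 ^ ((2 : Cardinal) ^ Cardinal.aleph0) ∧
  (∃ S ⊆ closedIdeals (X →L[𝕜] X), IsAntichain (· ≤ ·) S ∧
    Cardinal.mk S = 2 ^ ((2 : Cardinal) ^ Cardinal.aleph0)) ∧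
  (∃ C ⊆ closedIdeals (X →L[𝕜] X), IsChain (· ≤ ·) C ∧
    Cardinal.mk C = (2 : Cardinal) ^ Cardinal.aleph0)

/-- The sequence space with norm `max ((∑ |a j| ^ r) ^ (1 / r)) ((∑ |a j * u j| ^ 2) ^ (1 / 2))`
(all sequences `a` for which this is finite), realized isometrically as the subspace
`{(a, u a)}` of the sup-norm direct sum of `ℓ_r` and `ℓ_2`. -/
def rosenthalSubmodule (𝕜 : Type*) [RCLike 𝕜] (r : ℝ≥0∞) [Fact (1 ≤ r)] (u : ℕ → ℝ) :
    Submodule 𝕜 (lp (fun _ : ℕ => 𝕜) r × lp (fun _ : ℕ => 𝕜) 2) where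
  carrier := {x | ∀ j, x.2 j = (u j : 𝕜) * x.1 j}
  zero_mem' := by intro j; simp
  add_mem' := by
    intro x y hx hy j
    have h1 := hx j
    have h2 := hy j
    simp only [Prod.fst_add, Prod.snd_add, lp.coeFn_add, Pi.add_apply, h1, h2]
    ring
  smul_mem' := by
    intro c x hx j
    have h1 := hx j
    simp only [Prod.smul_fst, Prod.smul_snd, lp.coeFn_smul, Pi.smul_apply, smul_eq_mul, h1]
    ring

/-- The normed space given by `rosenthalSubmodule`, with the inherited norm. -/
def RosenthalSpace (𝕜 : Type*) [RCLike 𝕜] (r : ℝ≥0∞) [Fact (1 ≤ r)] (u : ℕ → ℝ) : Type _ :=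
  rosenthalSubmodule 𝕜 r u

noncomputable instance (𝕜 : Type*) [RCLike 𝕜] (r : ℝ≥0∞) [Fact (1 ≤ r)] (u : ℕ → ℝ) :
    NormedAddCommGroup (RosenthalSpace 𝕜 r u) :=
  inferInstanceAs (NormedAddCommGroup (rosenthalSubmodule 𝕜 r u))

noncomputable instance (𝕜 : Type*) [RCLike 𝕜] (r : ℝ≥0∞) [Fact (1 ≤ r)] (u : ℕ → ℝ) :
    NormedSpace 𝕜 (RosenthalSpace 𝕜 r u) :=
  inferInstanceAs (NormedSpace 𝕜 (rosenthalSubmodule 𝕜 r u))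

/-- The condition on a sequence `u` of positive reals under which (for `2 < r < ∞`) the space
`RosenthalSpace 𝕜 r u` is Rosenthal's space: for every `ε > 0` the sum of
`u j ^ (2 r / (r - 2))` over all `j` with `u j < ε` is infinite. -/
def IsRosenthalWeight (r : ℝ) (u : ℕ → ℝ) : Prop :=
  (∀ j, 0 < u j) ∧
    ∀ ε > 0, ¬ Summable fun j : {j : ℕ // u j < ε} => u j ^ (2 * r / (r - 2))

/-!
Let `B` be a bounded bilinear form on `E × F` and let `p > 2`. A *Rosenthal pair* of weight `w`
(`IsRosenthalPair`) is a biorthogonal system `f i ∈ E`, `g i ∈ F` such that `f` is dominated by the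
norm `(∑ |a i| ^ p) ^ (1 / p) + (∑ |w i * a i| ^ 2) ^ (1 / 2)`, while `g` is bounded and `w i • g i`
is dominated by the unit vector basis of `ℓ₂`. For `w = 1` this is a pair `x`, `y` of systems both
dominated by `ℓ₂`; as the weights decrease, `f` becomes more and more like the basis of `ℓ_p`.
Suppose that such pairs exist for all weights with values in `(0, 1]`.

Take blocks of indices with lengths `n k`, and weights `v k` on them, where `v k` decreases fast and
`n k` increases much faster (`IsBlockScale`), and let `f`, `g` be a Rosenthal pair with these
weights. For a set `α` of blocks let `T α : E → E` be the operator `z ↦ ∑ B(z, y j) f j`, the sum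
being over the indices in the blocks of `α`; it maps `x j` to `f j` for these `j` and kills the
other `x j`. Let `Φ k S` be the average of `B(S (x i), g i)` over the block `k`. Then
`Φ k (T α) = 1` for `k ∈ α`. The main point is that `Φ k (a * T α * a')` tends to `0` as `k → ∞`
outside `α`, for all operators `a`, `a'`. Up to the factor `1 / n k` this number is a double sum
`∑ i, ∑ j, b i j * h i (f j)`, with `i` in the block `k`, `j` in the other blocks, and `b` the
matrix of an operator on `ℓ₂`.
* The blocks `j` before `k` contain few indices compared with `n k`, and each column contributes a
  bounded multiple of `1 / v k` (`norm_trace_near_le`).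
* For the blocks after `k`, the sum is the mean over random signs `ε` of the pairing of
  `∑ ε i • h i` with `∑ j, (∑ i, ε i * b i j) • f j`. By Khintchine's inequality the coefficients
  `∑ i, ε i * b i j` have `ℓ_p`-norm of order `(n k) ^ (1 / p)` only, and their `ℓ₂`-norm, of order
  `(n k) ^ (1 / 2)`, enters with the factor `v (k + 1)`, which is small compared with `v k`
  (`norm_trace_far_le`).

Now let `(α y)`, `y ∈ ℝ`, be infinite sets of natural numbers with pairwise finite intersections.
For `X ⊆ ℝ` the operators `S` such that `Φ k (a * S * a') → 0` along `α y`, for all `a`, `a'` and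
all `y ∉ X`, form a closed ideal, and `T (α x)` belongs to it if and only if `x ∈ X`. So the power
set of `ℝ` embeds into the ordered set of closed ideals of `L(E)`
(`exists_closedIdeals_family_left`), and there are not more than `2 ^ 2 ^ ℵ₀` ideals because `E` is
separable. With the roles of `E` and `F` exchanged, the operators `g j ↦ y j` serve in the same way
for `L(F)` (`exists_closedIdeals_family_right`), which settles exponents below `2`.

Rosenthal pairs exist in `L_p(0, 1)` and `L_q(0, 1)` with `1 / p + 1 / q = 1`: independent symmetric
variables with values in `{0, c, -c}` satisfy the upper estimate by Rosenthal's inequality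
(`integral_norm_sum_rpow_le`). In `RosenthalSpace 𝕜 p u` and its dual they are found among the
blocks of the unit vector basis (`hasRosenthalPairs_rosenthalSpace`).
-/

open Filter Topology Set ProbabilityTheory

universe u

/-! ### An almost disjoint family indexed by the real numbers -/

/-- The sets `{(n, ⌊n y⌋) : n ∈ ℕ}`, coded as sets of natural numbers, form an almost disjoint
family indexed by `y : ℝ`: they are infinite, and by `almostDisjoint_inter_finite` any two of them
have finite intersection. -/
lemma almostDisjoint_infinite (y : ℝ) :
    (range fun n : ℕ => Encodable.encode (n, ⌊n * y⌋)).Infinite :=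
  infinite_range_of_injective fun _ _ h => congrArg Prod.fst (Encodable.encode_injective h)

lemma almostDisjoint_inter_finite {x y : ℝ} (hxy : x ≠ y) :
    ((range fun n : ℕ => Encodable.encode (n, ⌊n * x⌋)) ∩
      range fun n : ℕ => Encodable.encode (n, ⌊n * y⌋)).Finite := by
  obtain ⟨N, hN⟩ := exists_nat_gt (1 / |x - y|)
  refine ((finite_Iio N).image fun n : ℕ => Encodable.encode (n, ⌊n * x⌋)).subset ?_
  rintro k ⟨⟨m, rfl⟩, ⟨n, hn⟩⟩
  have h := Encodable.encode_injective hn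
  rw [Prod.mk.injEq] at h
  obtain ⟨rfl, h2⟩ := h
  refine ⟨n, ?_, rfl⟩
  -- Equal integer parts of `n x` and `n y` force `n * |x - y| < 1`.
  by_contra hlt
  rw [mem_Iio, not_lt] at hlt
  have h3 := Int.abs_sub_lt_one_of_floor_eq_floor h2
  rw [← mul_sub, abs_mul, Nat.abs_cast, abs_sub_comm] at h3
  have hpos : 0 < |x - y| := abs_pos.2 (sub_ne_zero.2 hxy)
  have h4 : 1 / |x - y| < n := hN.trans_le (by exact_mod_cast hlt)
  rw [div_lt_iff₀ hpos] at h4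
  linarith

/-! ### Closed ideals defined by a sequence of functionals -/

section Ideals

variable {𝕜 : Type*} [RCLike 𝕜] {A : Type*} [NormedRing A]

/-- The ideal of all `S` such that `Φ k (a * S * b)` tends to `0` along every filter in `F`, for all
`a` and `b`. The functionals are only required to be additive, which is all that the ideal property
needs. -/
def annihilatorIdeal (Φ : ℕ → A →+ 𝕜) (F : Set (Filter ℕ)) : TwoSidedIdeal A :=
  TwoSidedIdeal.mk' {S | ∀ a b, ∀ l ∈ F, Tendsto (fun k => Φ k (a * S * b)) l (𝓝 0)}
    (fun a b l _ => by simp [tendsto_const_nhds])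
    (fun {S T} hS hT a b l hl => by
      simpa [mul_add, add_mul] using (hS a b l hl).add (hT a b l hl))
    (fun {S} hS a b l hl => by simpa using (hS a b l hl).neg)
    (fun {c S} hS a b l hl => by simpa [mul_assoc] using hS (a * c) b l hl)
    (fun {S c} hS a b l hl => by simpa [mul_assoc] using hS a (c * b) l hl)

lemma mem_annihilatorIdeal {Φ : ℕ → A →+ 𝕜} {F : Set (Filter ℕ)} {S : A} :
    S ∈ annihilatorIdeal Φ F ↔
      ∀ a b, ∀ l ∈ F, Tendsto (fun k => Φ k (a * S * b)) l (𝓝 0) :=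
  TwoSidedIdeal.mem_mk' _ _ _ _ _ _ _

lemma isClosed_annihilatorIdeal {Φ : ℕ → A →+ 𝕜} {C : ℝ} (hC : ∀ k S, ‖Φ k S‖ ≤ C * ‖S‖)
    (F : Set (Filter ℕ)) : IsClosed (annihilatorIdeal Φ F : Set A) := by
  have hset : (annihilatorIdeal Φ F : Set A) =
      {S | ∀ a b, ∀ l ∈ F, Tendsto (fun k => Φ k (a * S * b)) l (𝓝 0)} := by
    ext S; exact mem_annihilatorIdeal
  rw [hset]
  refine isClosed_of_closure_subset fun S hS a b l hl => ?_
  have hC0 : 0 ≤ |C| := abs_nonneg C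
  rw [Metric.tendsto_nhds]
  intro ε hε
  set M := |C| * (‖a‖ * ‖b‖) + 1 with hM
  have hMpos : 0 < M := by positivity
  obtain ⟨T, hT, hd⟩ := Metric.mem_closure_iff.1 hS (ε / 2 / M) (by positivity)
  filter_upwards [Metric.tendsto_nhds.1 (hT a b l hl) (ε / 2) (by positivity)] with k hk
  rw [dist_zero_right] at hk ⊢
  have h1 : Φ k (a * S * b) = Φ k (a * T * b) + Φ k (a * (S - T) * b) := by
    rw [← map_add]; congr 1; noncomm_ring
  have h2 : ‖Φ k (a * (S - T) * b)‖ ≤ ε / 2 := by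
    calc ‖Φ k (a * (S - T) * b)‖ ≤ C * ‖a * (S - T) * b‖ := hC _ _
      _ ≤ |C| * (‖a‖ * ‖S - T‖ * ‖b‖) := by
        refine mul_le_mul (le_abs_self C) ?_ (norm_nonneg _) hC0
        exact (norm_mul_le _ _).trans (by gcongr; exact norm_mul_le _ _)
      _ = (|C| * (‖a‖ * ‖b‖)) * ‖S - T‖ := by ring
      _ ≤ M * (ε / 2 / M) := by
        rw [dist_eq_norm] at hd
        gcongr
        linarith
      _ = ε / 2 := by field_simp
  rw [h1]
  exact (norm_add_le _ _).trans_lt (by linarith)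

/-- If `Φ k (T α) = 1` for `k ∈ α`, whereas `Φ k (a * T α * b)` tends to `0` as `k → ∞` outside `α`,
then the power set of `ℝ` embeds into the ordered set of closed ideals. -/
lemma exists_closedIdeals_family (T : Set ℕ → A) (Φ : ℕ → A →+ 𝕜) {C : ℝ}
    (hC : ∀ k S, ‖Φ k S‖ ≤ C * ‖S‖) (h1 : ∀ α, ∀ k ∈ α, Φ k (T α) = 1)
    (h0 : ∀ α a b, Tendsto (fun k => Φ k (a * T α * b)) (atTop ⊓ 𝓟 αᶜ) (𝓝 0)) :
    ∃ J : Set ℝ ↪o TwoSidedIdeal A, ∀ X, J X ∈ closedIdeals A := by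
  -- `J X` consists of the elements annihilated along `α y` for every `y` outside `X`.
  let α : ℝ → Set ℕ := fun y => range fun n : ℕ => Encodable.encode (n, ⌊n * y⌋)
  let J : Set ℝ → TwoSidedIdeal A := fun X =>
    annihilatorIdeal Φ ((fun y => atTop ⊓ 𝓟 (α y)) '' Xᶜ)
  have hmem : ∀ x X, T (α x) ∈ J X ↔ x ∈ X := by
    intro x X
    rw [mem_annihilatorIdeal]
    constructor
    · intro h
      by_contra hx
      have h2 := h 1 1 _ (mem_image_of_mem _ hx)
      have h3 : Tendsto (fun k => Φ k (1 * T (α x) * 1)) (atTop ⊓ 𝓟 (α x)) (𝓝 1) := by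
        refine tendsto_const_nhds.congr' ?_
        filter_upwards [mem_inf_of_right (mem_principal_self _)] with k hk
        rw [one_mul, mul_one, h1 _ k hk]
      have : (atTop ⊓ 𝓟 (α x)).NeBot := by
        rw [← Nat.cofinite_eq_atTop, cofinite_inf_principal_neBot_iff]
        exact almostDisjoint_infinite x
      exact one_ne_zero (tendsto_nhds_unique h3 h2)
    · rintro hx a b _ ⟨y, hy, rfl⟩
      refine (h0 (α x) a b).mono_left (le_inf inf_le_left ?_)
      have hfin : (α y ∩ α x).Finite :=
        almostDisjoint_inter_finite fun h => hy (h ▸ hx)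
      rw [le_principal_iff, mem_inf_principal, ← Nat.cofinite_eq_atTop, mem_cofinite]
      refine hfin.subset fun k hk => ?_
      simpa using hk
  refine ⟨OrderEmbedding.ofMapLEIff J fun X Y => ⟨fun h x hx => ?_, fun h => ?_⟩, fun X => ?_⟩
  · exact (hmem x Y).1 (h ((hmem x X).2 hx))
  · intro S hS
    change S ∈ annihilatorIdeal _ _ at hS
    change S ∈ annihilatorIdeal _ _
    rw [mem_annihilatorIdeal] at hS ⊢
    exact fun a b l hl => hS a b l (image_mono (compl_subset_compl.2 h) hl)
  · exact isClosed_annihilatorIdeal hC _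

end Ideals

/-! ### Cardinalities -/

section Cardinality

open Cardinal

lemma mk_le_continuum_of_separable (X : Type u) [MetricSpace X]
    [TopologicalSpace.SeparableSpace X] : #X ≤ 𝔠 := by
  have h : SecondCountableTopology X := UniformSpace.secondCountable_of_separable X
  obtain ⟨b, hbc, -, hb⟩ := TopologicalSpace.exists_countable_basis X
  have : Function.Injective fun x : X => {s : b | x ∈ s.1} := by
    intro x y hxy
    by_contra hne
    obtain ⟨s, hs, hxs, hsy⟩ := hb.exists_subset_of_mem_open
      (show x ∈ ({y}ᶜ : Set X) from hne) isOpen_compl_singleton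
    have : (⟨s, hs⟩ : b) ∈ {s : b | y ∈ s.1} :=
      hxy.subset (show (⟨s, hs⟩ : b) ∈ {s : b | x ∈ s.1} from hxs)
    exact hsy this rfl
  calc #X ≤ #(Set b) := mk_le_of_injective this
    _ = 2 ^ #b := mk_set
    _ ≤ 2 ^ ℵ₀ := power_le_power_left two_ne_zero (mk_le_aleph0_iff.2 hbc.to_subtype)
    _ = 𝔠 := two_power_aleph0

lemma mk_continuousLinearMap_le (𝕜 : Type*) (X : Type u) [RCLike 𝕜] [NormedAddCommGroup X]
    [NormedSpace 𝕜 X] [TopologicalSpace.SeparableSpace X] : #(X →L[𝕜] X) ≤ 𝔠 := by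
  obtain ⟨s, hsc, hsd⟩ := TopologicalSpace.exists_countable_dense X
  have : Function.Injective fun (T : X →L[𝕜] X) (x : s) => T x := by
    intro S T h
    refine DFunLike.coe_injective (Continuous.ext_on hsd S.continuous T.continuous ?_)
    exact fun x hx => congrFun h ⟨x, hx⟩
  calc #(X →L[𝕜] X) ≤ #(s → X) := mk_le_of_injective this
    _ = #X ^ #s := by simp
    _ ≤ 𝔠 ^ #s := power_le_power_right (mk_le_continuum_of_separable X)
    _ ≤ 𝔠 ^ ℵ₀ := power_le_power_left continuum_ne_zero (mk_le_aleph0_iff.2 hsc.to_subtype)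
    _ = 𝔠 := continuum_power_aleph0

/-- Splitting `ℝ` into two copies of itself (by the sign) and sending `X` to the union of `X` in one
copy and its complement in the other makes inclusions into equalities. -/
lemma exists_antichain_set_real :
    ∃ f : Set ℝ → Set ℝ, Function.Injective f ∧ ∀ X Y, f X ⊆ f Y → X = Y := by
  have key : ∃ f : Set ℝ → Set ℝ, ∀ X Y, f X ⊆ f Y → X = Y := by
    -- For `x < 0`, Mathlib defines `Real.log x` as the logarithm of `|x|`.
    refine ⟨fun X => {x | (0 < x ∧ Real.log x ∈ X) ∨ (x < 0 ∧ Real.log x ∉ X)}, ?_⟩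
    intro X Y h
    ext t
    constructor
    · intro ht
      have := h (show Real.exp t ∈ _ from Or.inl ⟨Real.exp_pos t, by simpa using ht⟩)
      rcases this with h' | h'
      · simpa using h'.2
      · exact absurd h'.1 (Real.exp_pos t).not_gt
    · intro ht
      by_contra hX
      have := h (show -Real.exp t ∈ _ from Or.inr
        ⟨neg_lt_zero.2 (Real.exp_pos t), by simpa using hX⟩)
      rcases this with h' | h'
      · exact absurd h'.1 (neg_lt_zero.2 (Real.exp_pos t)).not_gt
      · exact h'.2 (by simpa using ht)
  obtain ⟨f, hf⟩ := key
  exact ⟨f, fun X Y h => hf X Y h.subset, hf⟩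

theorem hasManyClosedIdeals_of_orderEmbedding {𝕜 X : Type*} [RCLike 𝕜] [NormedAddCommGroup X]
    [NormedSpace 𝕜 X] [TopologicalSpace.SeparableSpace X] (J : Set ℝ ↪o TwoSidedIdeal (X →L[𝕜] X))
    (hJ : ∀ s, J s ∈ closedIdeals (X →L[𝕜] X)) : HasManyClosedIdeals 𝕜 X := by
  have hcard : #(Set ℝ) = 2 ^ ((2 : Cardinal) ^ ℵ₀) := by rw [mk_set, mk_real, two_power_aleph0]
  have hupper : #(closedIdeals (X →L[𝕜] X)) ≤ 2 ^ ((2 : Cardinal) ^ ℵ₀) := by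
    calc #(closedIdeals (X →L[𝕜] X)) ≤ #(TwoSidedIdeal (X →L[𝕜] X)) := mk_set_le _
      _ ≤ #(Set (X →L[𝕜] X)) := mk_le_of_injective SetLike.coe_injective
      _ = 2 ^ #(X →L[𝕜] X) := mk_set
      _ ≤ 2 ^ ((2 : Cardinal) ^ ℵ₀) := power_le_power_left two_ne_zero (by
        rw [two_power_aleph0]; exact mk_continuousLinearMap_le 𝕜 X)
  obtain ⟨f, hfi, hf⟩ := exists_antichain_set_real
  have hrange : #(range (J ∘ f)) = 2 ^ ((2 : Cardinal) ^ ℵ₀) := by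
    have := mk_range_eq_of_injective (J.injective.comp hfi)
    rw [hcard] at this
    simpa using this
  have hsub : range (J ∘ f) ⊆ closedIdeals (X →L[𝕜] X) := by
    rintro _ ⟨s, rfl⟩; exact hJ _
  -- The chain is the image of the half-lines, which are nested.
  refine ⟨le_antisymm hupper (hrange ▸ mk_le_mk_of_subset hsub),
    ⟨_, hsub, ?_, hrange⟩, ⟨range (J ∘ Iic), ?_, ?_, ?_⟩⟩
  · rintro _ ⟨s, rfl⟩ _ ⟨t, rfl⟩ hne hle
    exact hne (by rw [hf s t (J.le_iff_le.1 hle)])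
  · rintro _ ⟨s, rfl⟩; exact hJ _
  · rintro _ ⟨s, rfl⟩ _ ⟨t, rfl⟩ -
    rcases le_total s t with h | h
    · exact Or.inl (J.le_iff_le.2 (Iic_subset_Iic.2 h))
    · exact Or.inr (J.le_iff_le.2 (Iic_subset_Iic.2 h))
  · have := mk_range_eq_of_injective (J.injective.comp Iic_injective)
    rw [mk_real, ← two_power_aleph0] at this
    simpa using this

end Cardinality

/-! ### Estimates in terms of finite `ℓ₂` sums -/

/-- The `ℓ₂` norm of the restriction of `c` to the finite set `s`. -/
noncomputable def finL2 {ι 𝕜 : Type*} [RCLike 𝕜] (s : Finset ι) (c : ι → 𝕜) : ℝ :=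
  √(∑ i ∈ s, ‖c i‖ ^ 2)

section L2

variable {ι κ 𝕜 : Type*} [RCLike 𝕜]

lemma finL2_nonneg (s : Finset ι) (c : ι → 𝕜) : 0 ≤ finL2 s c := Real.sqrt_nonneg _

lemma finL2_sq (s : Finset ι) (c : ι → 𝕜) : finL2 s c ^ 2 = ∑ i ∈ s, ‖c i‖ ^ 2 :=
  Real.sq_sqrt (Finset.sum_nonneg fun _ _ => by positivity)

lemma finL2_le_of_norm_le {s : Finset ι} {c : ι → 𝕜} {r : ℝ} (hc : ∀ i ∈ s, ‖c i‖ ≤ r) :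
    finL2 s c ≤ r * √s.card := by
  rcases s.eq_empty_or_nonempty with rfl | ⟨i, hi⟩
  · simp [finL2]
  have hr : 0 ≤ r := (norm_nonneg _).trans (hc i hi)
  rw [finL2, Real.sqrt_le_left (by positivity), mul_pow, Real.sq_sqrt (by positivity), mul_comm,
    ← nsmul_eq_mul]
  exact Finset.sum_le_card_nsmul _ _ _ fun i hi => by have := hc i hi; gcongr

/-- The converse of the Cauchy–Schwarz inequality. -/
lemma finL2_le_of_dual {s : Finset ι} {z : ι → 𝕜} {M : ℝ} (hM : 0 ≤ M)
    (h : ∀ d : ι → 𝕜, ‖∑ i ∈ s, d i * z i‖ ≤ M * finL2 s d) : finL2 s z ≤ M := by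
  have h1 := h fun i => (starRingEnd 𝕜) (z i)
  have h2 : finL2 s (fun i => (starRingEnd 𝕜) (z i)) = finL2 s z := by simp [finL2]
  have h3 : ‖∑ i ∈ s, (starRingEnd 𝕜) (z i) * z i‖ = finL2 s z ^ 2 := by
    simp_rw [RCLike.conj_mul]
    rw [finL2_sq]
    norm_cast
    exact abs_of_nonneg (Finset.sum_nonneg fun _ _ => by positivity)
  rw [h2, h3] at h1
  rcases (finL2_nonneg s z).eq_or_lt with h0 | h0
  · rwa [← h0]
  · nlinarith

/-- The matrix `b` defines a bounded operator from `ℓ₂(ι)` to `ℓ₂(κ)` of norm at most `D`, expressed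
through the bilinear form on finitely supported vectors. -/
def IsL2Bounded (D : ℝ) (b : ι → κ → 𝕜) : Prop :=
  ∀ (s : Finset ι) (t : Finset κ) (c : ι → 𝕜) (d : κ → 𝕜),
    ‖∑ j ∈ t, d j * ∑ i ∈ s, c i * b i j‖ ≤ D * finL2 s c * finL2 t d

variable {D : ℝ} {b : ι → κ → 𝕜}

lemma IsL2Bounded.finL2_sum_le (hD : 0 ≤ D) (hb : IsL2Bounded D b) (s : Finset ι) (t : Finset κ)
    (c : ι → 𝕜) : finL2 t (fun j => ∑ i ∈ s, c i * b i j) ≤ D * finL2 s c :=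
  finL2_le_of_dual (mul_nonneg hD (finL2_nonneg _ _)) fun d => hb s t c d

lemma IsL2Bounded.finL2_row_le (hD : 0 ≤ D) (hb : IsL2Bounded D b) (t : Finset κ) (i : ι) :
    finL2 t (b i) ≤ D := by
  simpa [finL2] using hb.finL2_sum_le hD {i} t fun _ => 1

lemma IsL2Bounded.finL2_col_le (hD : 0 ≤ D) (hb : IsL2Bounded D b) (s : Finset ι) (j : κ) :
    finL2 s (fun i => b i j) ≤ D :=
  finL2_le_of_dual hD fun c => by simpa [finL2] using hb s {j} c fun _ => 1

end L2

/-- The concave function `x ^ (1 / p)` is bounded by an affine function whose coefficients are of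
the right order at `x = N`; this replaces an appeal to Jensen's inequality. -/
lemma rpow_inv_le_add {p N x : ℝ} (hp : 1 ≤ p) (hN : 0 < N) (hx : 0 ≤ x) :
    x ^ (1 / p) ≤ N ^ (1 / p) + N ^ (1 / p - 1) * x := by
  have hp0 : 0 < p := by linarith
  rcases le_total x N with h | h
  · have : x ^ (1 / p) ≤ N ^ (1 / p) := Real.rpow_le_rpow hx h (by positivity)
    have h2 : 0 ≤ N ^ (1 / p - 1) * x := by positivity
    linarith
  · have hx0 : 0 < x := hN.trans_le h
    have h1 : x ^ (1 / p) = x ^ (1 / p - 1) * x := by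
      rw [Real.rpow_sub_one hx0.ne']; field_simp
    have h3 : 1 / p - 1 ≤ 0 := by
      rw [sub_nonpos, div_le_one hp0]; exact hp
    have h2 : x ^ (1 / p - 1) ≤ N ^ (1 / p - 1) := Real.rpow_le_rpow_of_nonpos hN h h3
    have h4 : 0 ≤ N ^ (1 / p) := by positivity
    rw [h1]
    nlinarith

/-! ### Two bounds for traces over a block -/

/-- Bounded orthonormal functions `ε i` whose linear combinations satisfy the `p`-th power of
Khintchine's inequality with constant `K`. -/
structure IsKhintchine (𝕜 : Type*) [RCLike 𝕜] {ι Ω : Type*} [MeasurableSpace Ω] (μ : Measure Ω)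
    (p K : ℝ) (ε : ι → Ω → ℝ) : Prop where
  measurable : ∀ i, Measurable (ε i)
  abs_le : ∀ i ω, |ε i ω| ≤ 1
  integral_sq : ∀ i, ∫ ω, ε i ω * ε i ω ∂μ = 1
  integral_mul : ∀ i j, i ≠ j → ∫ ω, ε i ω * ε j ω ∂μ = 0
  integral_norm_rpow_le : ∀ (s : Finset ι) (c : ι → 𝕜),
    ∫ ω, ‖∑ i ∈ s, (ε i ω : 𝕜) * c i‖ ^ p ∂μ ≤ K * finL2 s c ^ p

section Trace

variable {ι κ 𝕜 E Ω : Type*} [RCLike 𝕜] [NormedAddCommGroup E] [NormedSpace 𝕜 E]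

/-- The system `f` is dominated by the norm of Rosenthal's space with weight `w`. The scalar field
is an implicit argument that `f` does not determine. -/
def HasUpperEstimate (p C : ℝ) (w : κ → ℝ) (f : κ → E) : Prop :=
  ∀ (s : Finset κ) (a : κ → 𝕜), ‖∑ j ∈ s, a j • f j‖ ≤
    C * ((∑ j ∈ s, ‖a j‖ ^ p) ^ (1 / p) + finL2 s fun j => (w j : 𝕜) * a j)

variable {p C D H K : ℝ} {w : κ → ℝ} {f : κ → E} {h : ι → E →L[𝕜] 𝕜} {b : ι → κ → 𝕜}

/-- The bound for the blocks after the given one `I`, on which the weights are at most `v`. The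
trace is the mean over the signs `ε` of the pairing of `∑ ε i • h i` with
`∑ j, (∑ i, ε i * b i j) • f j`. -/
lemma norm_trace_far_le [MeasurableSpace Ω] {μ : Measure Ω} [IsProbabilityMeasure μ]
    {ε : ι → Ω → ℝ} (hp : 2 < p) (hC : 0 ≤ C) (hD : 0 < D) (hH : 0 ≤ H) (hK : 0 ≤ K)
    (hε : IsKhintchine 𝕜 μ p K ε) (hf : HasUpperEstimate (𝕜 := 𝕜) p C w f)
    (hb : IsL2Bounded D b) {I : Finset ι} (hI : I.Nonempty)
    (hh : ∀ c : ι → 𝕜, ‖∑ i ∈ I, c i • h i‖ ≤ H * finL2 I c)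
    {t : Finset κ} {v : ℝ} (hw : ∀ j ∈ t, |w j| ≤ v) (hv : 0 ≤ v) :
    ‖∑ i ∈ I, ∑ j ∈ t, b i j * h i (f j)‖ ≤
      H * √(I.card : ℝ) *
        (C * ((I.card : ℝ) ^ (1 / p) * (1 + K * D ^ p) + v * (D * √(I.card : ℝ)))) := by
  classical
  set n : ℝ := (I.card : ℝ) with hn
  have hn0 : 0 < n := by rw [hn]; exact_mod_cast Finset.card_pos.2 hI
  let β : Ω → κ → 𝕜 := fun ω j => ∑ i ∈ I, (ε i ω : 𝕜) * b i j
  let G : Ω → 𝕜 := fun ω => ∑ i' ∈ I, ∑ i ∈ I,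
    ((ε i' ω * ε i ω : ℝ) : 𝕜) * ∑ j ∈ t, b i j * h i' (f j)
  have hεint : ∀ i j, Integrable (fun ω => ε i ω * ε j ω) μ := fun i j =>
    Integrable.of_bound ((hε.measurable i).mul (hε.measurable j)).aestronglyMeasurable 1
      (ae_of_all _ fun ω => by
        rw [Real.norm_eq_abs, abs_mul]
        exact mul_le_one₀ (hε.abs_le i ω) (abs_nonneg _) (hε.abs_le j ω))
  have hGint : ∫ ω, G ω ∂μ = ∑ i ∈ I, ∑ j ∈ t, b i j * h i (f j) := by
    have h1 : ∀ i i', ∫ ω, ((ε i' ω * ε i ω : ℝ) : 𝕜) ∂μ = if i = i' then 1 else 0 := by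
      intro i i'
      rw [integral_ofReal]
      split_ifs with hii
      · subst hii; rw [hε.integral_sq]; simp
      · rw [hε.integral_mul _ _ (Ne.symm hii)]; simp
    rw [integral_finsetSum _ fun i' _ => integrable_finsetSum _ fun i _ =>
      ((hεint i' i).ofReal).mul_const _]
    refine Finset.sum_congr rfl fun i' hi' => ?_
    rw [integral_finsetSum _ fun i _ => ((hεint i' i).ofReal).mul_const _]
    simp_rw [integral_mul_const, h1, ite_mul, one_mul, zero_mul]
    rw [Finset.sum_ite_eq' I i', if_pos hi']
  have hG : ∀ ω, G ω = (∑ i ∈ I, (ε i ω : 𝕜) • h i) (∑ j ∈ t, β ω j • f j) := by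
    intro ω
    rw [sum_apply]
    refine Finset.sum_congr rfl fun i' _ => ?_
    rw [smul_apply, map_sum]
    simp only [β, map_smul, smul_eq_mul]
    simp only [Finset.mul_sum, Finset.sum_mul]
    rw [Finset.sum_comm (s := I)]
    refine Finset.sum_congr rfl fun j _ => Finset.sum_congr rfl fun i _ => ?_
    push_cast
    ring
  have hεn : ∀ ω, finL2 I (fun i => (ε i ω : 𝕜)) ≤ √n := fun ω => by
    simpa using finL2_le_of_norm_le (s := I) (c := fun i => (ε i ω : 𝕜)) (r := 1) fun i _ => by
      simpa using hε.abs_le i ω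
  have hβ2 : ∀ ω, finL2 t (fun j => (w j : 𝕜) * β ω j) ≤ v * (D * √n) := by
    intro ω
    have h1 : finL2 t (fun j => (w j : 𝕜) * β ω j) ≤ v * finL2 t (β ω) := by
      rw [finL2, Real.sqrt_le_left (mul_nonneg hv (finL2_nonneg _ _)), mul_pow, finL2_sq,
        Finset.mul_sum]
      refine Finset.sum_le_sum fun j hj => ?_
      rw [norm_mul, mul_pow]
      have := hw j hj
      gcongr
      simpa using this
    refine h1.trans (mul_le_mul_of_nonneg_left ?_ hv)
    exact (hb.finL2_sum_le hD.le I t _).trans (mul_le_mul_of_nonneg_left (hεn ω) hD.le)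
  let Q : Ω → ℝ := fun ω => ∑ j ∈ t, ‖β ω j‖ ^ p
  have hQ0 : ∀ ω, 0 ≤ Q ω := fun ω => Finset.sum_nonneg fun _ _ => by positivity
  have hβmeas : ∀ j, Measurable fun ω => β ω j := fun j =>
    Finset.measurable_sum _ fun i _ =>
      ((RCLike.measurable_ofReal.comp (hε.measurable i))).mul_const _
  have hQi : ∀ j, Integrable (fun ω => ‖β ω j‖ ^ p) μ := by
    intro j
    refine Integrable.of_bound ((hβmeas j).norm.pow_const p).aestronglyMeasurable
      ((∑ i ∈ I, ‖b i j‖) ^ p) (ae_of_all _ fun ω => ?_)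
    rw [Real.norm_of_nonneg (by positivity)]
    refine Real.rpow_le_rpow (norm_nonneg _) ((norm_sum_le _ _).trans ?_) (by linarith)
    refine Finset.sum_le_sum fun i _ => ?_
    rw [norm_mul]
    refine mul_le_of_le_one_left (norm_nonneg _) ?_
    simpa using hε.abs_le i ω
  have hQint : ∫ ω, Q ω ∂μ ≤ K * D ^ p * n := by
    rw [integral_finsetSum _ fun j _ => hQi j]
    calc ∑ j ∈ t, ∫ ω, ‖β ω j‖ ^ p ∂μ
        ≤ ∑ j ∈ t, K * (D ^ (p - 2) * finL2 I (fun i => b i j) ^ 2) := by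
          refine Finset.sum_le_sum fun j _ => (hε.integral_norm_rpow_le I _).trans ?_
          refine mul_le_mul_of_nonneg_left ?_ hK
          have h1 := finL2_nonneg I fun i => b i j
          have h2 := hb.finL2_col_le hD.le I j
          have h3 : finL2 I (fun i => b i j) ^ p =
              finL2 I (fun i => b i j) ^ (p - 2) * finL2 I (fun i => b i j) ^ 2 := by
            rw [← Real.rpow_natCast, ← Real.rpow_add_of_nonneg h1 (by linarith) (by norm_num)]
            norm_num
          rw [h3]
          gcongr
      _ = K * D ^ (p - 2) * ∑ i ∈ I, finL2 t (b i) ^ 2 := by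
          simp_rw [finL2_sq]
          rw [Finset.sum_comm, Finset.mul_sum]
          refine Finset.sum_congr rfl fun j _ => by ring
      _ ≤ K * D ^ (p - 2) * ∑ i ∈ I, D ^ 2 := by
          have := fun i => hb.finL2_row_le hD.le t i
          have h1 := fun i => finL2_nonneg t (b i)
          gcongr with i hi
          · exact h1 i
          · exact this i
      _ = K * D ^ p * n := by
          rw [Finset.sum_const, nsmul_eq_mul, ← hn]
          have : D ^ p = D ^ (p - 2) * D ^ 2 := by
            rw [← Real.rpow_natCast, ← Real.rpow_add hD]; norm_num
          rw [this]; ring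
  have hQintble : Integrable Q μ := integrable_finsetSum _ fun j _ => hQi j
  -- The random `p`-th root is replaced by its affine bound at the mean order of magnitude `n`.
  have hGle : ∀ ω, ‖G ω‖ ≤ H * √n * (C * ((n ^ (1 / p) + n ^ (1 / p - 1) * Q ω) +
      v * (D * √n))) := by
    intro ω
    rw [hG]
    refine (ContinuousLinearMap.le_opNorm _ _).trans ?_
    refine mul_le_mul ((hh _).trans (mul_le_mul_of_nonneg_left (hεn ω) hH)) ?_ (norm_nonneg _)
      (by positivity)
    refine (hf t (β ω)).trans (mul_le_mul_of_nonneg_left (add_le_add ?_ (hβ2 ω)) hC)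
    exact rpow_inv_le_add (by linarith) hn0 (hQ0 ω)
  rw [← hGint]
  refine (norm_integral_le_of_norm_le ?_ (ae_of_all _ hGle)).trans ?_
  · exact (((((integrable_const _).add (hQintble.const_mul _))).add
      (integrable_const _)).const_mul _).const_mul _
  rw [integral_const_mul, integral_const_mul, integral_add (by fun_prop) (by fun_prop),
    integral_add (by fun_prop) (by fun_prop), integral_const_mul]
  simp only [integral_const, probReal_univ, smul_eq_mul, one_mul]
  have hnp : n ^ (1 / p - 1) * n = n ^ (1 / p) := by
    rw [Real.rpow_sub_one hn0.ne']; field_simp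
  gcongr
  calc n ^ (1 / p) + n ^ (1 / p - 1) * ∫ ω, Q ω ∂μ
      ≤ n ^ (1 / p) + n ^ (1 / p - 1) * (K * D ^ p * n) := by gcongr
    _ = n ^ (1 / p) + (n ^ (1 / p - 1) * n) * (K * D ^ p) := by ring
    _ = n ^ (1 / p) * (1 + K * D ^ p) := by rw [hnp]; ring

/-- The bound for the finitely many indices `t` before the given block `I`: each column of the trace
is bounded separately. -/
lemma norm_trace_near_le (hD : 0 ≤ D) (hH : 0 ≤ H) (hb : IsL2Bounded D b) {I : Finset ι}
    (hh : ∀ c : ι → 𝕜, ‖∑ i ∈ I, c i • h i‖ ≤ H * finL2 I c)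
    {t : Finset κ} {M : ℝ} (hf : ∀ j ∈ t, ‖f j‖ ≤ M) :
    ‖∑ i ∈ I, ∑ j ∈ t, b i j * h i (f j)‖ ≤ t.card * (H * D * M) := by
  rw [Finset.sum_comm, ← nsmul_eq_mul]
  refine (norm_sum_le _ _).trans (Finset.sum_le_card_nsmul _ _ _ fun j hj => ?_)
  have h1 : ∑ i ∈ I, b i j * h i (f j) = (∑ i ∈ I, b i j • h i) (f j) := by
    simp
  rw [h1]
  refine (ContinuousLinearMap.le_opNorm _ _).trans
    (mul_le_mul ((hh _).trans ?_) (hf j hj) (norm_nonneg _) (by positivity))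
  exact mul_le_mul_of_nonneg_left (hb.finL2_col_le hD I j) hH

end Trace

/-! ### Operators that factor through `ℓ₂` -/

section Operators

variable {ι 𝕜 E F : Type*} [RCLike 𝕜] [NormedAddCommGroup E] [NormedSpace 𝕜 E]
  [NormedAddCommGroup F] [NormedSpace 𝕜 F]

lemma finL2_apply_le {C : ℝ} (hC : 0 ≤ C) {φ : ι → E →L[𝕜] 𝕜}
    (hφ : ∀ (s : Finset ι) (c : ι → 𝕜), ‖∑ i ∈ s, c i • φ i‖ ≤ C * finL2 s c)
    (s : Finset ι) (z : E) : finL2 s (fun i => φ i z) ≤ C * ‖z‖ := by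
  refine finL2_le_of_dual (by positivity) fun d => ?_
  have h1 : ∑ i ∈ s, d i * φ i z = (∑ i ∈ s, d i • φ i) z := by simp
  rw [h1]
  refine (ContinuousLinearMap.le_opNorm _ _).trans ?_
  calc _ ≤ C * finL2 s d * ‖z‖ := by gcongr; exact hφ s d
    _ = _ := by ring

/-- If both `φ` and `v` are dominated by the basis of `ℓ₂`, then `z ↦ ∑ φ i (z) v i` is a bounded
operator; it factors through `ℓ₂`. -/
lemma exists_hasSum_operator [CompleteSpace F] {C C' : ℝ} (hC : 0 ≤ C) (hC' : 0 ≤ C')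
    {φ : ι → E →L[𝕜] 𝕜} {v : ι → F}
    (hφ : ∀ (s : Finset ι) (c : ι → 𝕜), ‖∑ i ∈ s, c i • φ i‖ ≤ C * finL2 s c)
    (hv : ∀ (s : Finset ι) (c : ι → 𝕜), ‖∑ i ∈ s, c i • v i‖ ≤ C' * finL2 s c) :
    ∃ T : E →L[𝕜] F, ∀ z, HasSum (fun i => φ i z • v i) (T z) := by
  have hsum : ∀ z, Summable fun i => φ i z • v i := by
    intro z
    have hsq : Summable fun i => ‖φ i z‖ ^ 2 := by
      refine summable_of_sum_le (c := (C * ‖z‖) ^ 2) (fun i => by positivity) fun s => ?_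
      rw [← finL2_sq s fun i => φ i z]
      have := finL2_apply_le hC hφ s z
      have h0 := finL2_nonneg s fun i => φ i z
      gcongr
    rw [summable_iff_vanishing_norm] at hsq ⊢
    intro ε hε
    obtain ⟨s, hs⟩ := hsq ((ε / (C' + 1)) ^ 2) (by positivity)
    refine ⟨s, fun t ht => ?_⟩
    have h1 := hs t ht
    rw [Real.norm_of_nonneg (Finset.sum_nonneg fun _ _ => by positivity),
      ← finL2_sq t fun i => φ i z] at h1
    have h2 := lt_of_pow_lt_pow_left₀ 2 (by positivity) h1
    have h0 := finL2_nonneg t fun i => φ i z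
    calc _ ≤ C' * finL2 t fun i => φ i z := hv t _
      _ ≤ (C' + 1) * finL2 t fun i => φ i z := by gcongr; linarith
      _ < (C' + 1) * (ε / (C' + 1)) := by gcongr
      _ = ε := by field_simp
  refine ⟨LinearMap.mkContinuous
    { toFun := fun z => ∑' i, φ i z • v i
      map_add' := fun x y => by
        rw [← (hsum x).tsum_add (hsum y)]
        simp only [map_add, add_smul]
      map_smul' := fun c x => by
        rw [RingHom.id_apply, ← (hsum x).tsum_const_smul]
        simp only [map_smul, smul_assoc] } (C' * C) fun z => ?_, fun z => (hsum z).hasSum⟩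
  refine le_of_tendsto (hsum z).hasSum.norm (Eventually.of_forall fun s => ?_)
  calc _ ≤ C' * finL2 s fun i => φ i z := hv s _
    _ ≤ C' * (C * ‖z‖) := by gcongr; exact finL2_apply_le hC hφ s z
    _ = _ := by ring

lemma rpow_sum_rpow_le_finL2 {p : ℝ} (hp : 2 < p) (s : Finset ι) (c : ι → 𝕜) :
    (∑ i ∈ s, ‖c i‖ ^ p) ^ (1 / p) ≤ finL2 s c := by
  have h0 := finL2_nonneg s c
  have h2 : ∑ i ∈ s, ‖c i‖ ^ p ≤ finL2 s c ^ p := by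
    have hsplit : ∀ x : ℝ, 0 ≤ x → x ^ p = x ^ (p - 2) * x ^ 2 := fun x hx => by
      rw [← Real.rpow_natCast, ← Real.rpow_add_of_nonneg hx (by linarith) (by norm_num)]
      norm_num
    rw [hsplit _ h0, finL2_sq, Finset.mul_sum]
    refine Finset.sum_le_sum fun i hi => ?_
    rw [hsplit _ (norm_nonneg _)]
    have : ‖c i‖ ≤ finL2 s c := by
      refine Real.le_sqrt_of_sq_le ?_
      exact Finset.single_le_sum (f := fun i => ‖c i‖ ^ 2) (fun _ _ => by positivity) hi
    have hp2 : 0 ≤ p - 2 := by linarith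
    gcongr
  calc _ ≤ (finL2 s c ^ p) ^ (1 / p) :=
        Real.rpow_le_rpow (Finset.sum_nonneg fun _ _ => by positivity) h2 (by positivity)
    _ = finL2 s c := by rw [one_div, Real.rpow_rpow_inv h0 (by linarith)]

lemma norm_sum_smul_le_of_upper {p C : ℝ} (hp : 2 < p) (hC : 0 ≤ C) {w : ι → ℝ}
    (hw : ∀ i, 0 < w i ∧ w i ≤ 1) {f : ι → E} (hf : HasUpperEstimate (𝕜 := 𝕜) p C w f)
    (s : Finset ι) (c : ι → 𝕜) : ‖∑ i ∈ s, c i • f i‖ ≤ 2 * C * finL2 s c := by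
  have h1 := rpow_sum_rpow_le_finL2 hp s c
  have h3 : finL2 s (fun i => (w i : 𝕜) * c i) ≤ finL2 s c := by
    refine Real.sqrt_le_sqrt (Finset.sum_le_sum fun i _ => ?_)
    rw [norm_mul, RCLike.norm_ofReal, abs_of_pos (hw i).1]
    have := mul_le_of_le_one_left (norm_nonneg (c i)) (hw i).2
    have hwi := (hw i).1
    gcongr
  calc _ ≤ C * ((∑ i ∈ s, ‖c i‖ ^ p) ^ (1 / p) + finL2 s fun i => (w i : 𝕜) * c i) := hf s c
    _ ≤ C * (finL2 s c + finL2 s c) := by gcongr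
    _ = _ := by ring

lemma isL2Bounded_pairing {κ : Type*} (B : E →L[𝕜] F →L[𝕜] 𝕜) {C C' : ℝ} (hC : 0 ≤ C)
    {x : ι → E} {y : κ → F}
    (hx : ∀ (s : Finset ι) (c : ι → 𝕜), ‖∑ i ∈ s, c i • x i‖ ≤ C * finL2 s c)
    (hy : ∀ (s : Finset κ) (c : κ → 𝕜), ‖∑ i ∈ s, c i • y i‖ ≤ C' * finL2 s c) :
    IsL2Bounded (‖B‖ * C * C') fun i j => B (x i) (y j) := by
  intro s t c d
  have h1 : ∑ j ∈ t, d j * ∑ i ∈ s, c i * B (x i) (y j) =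
      B (∑ i ∈ s, c i • x i) (∑ j ∈ t, d j • y j) := by
    simp [map_sum, sum_apply]
  rw [h1]
  have h2 := finL2_nonneg s c
  calc _ ≤ ‖B‖ * ‖∑ i ∈ s, c i • x i‖ * ‖∑ j ∈ t, d j • y j‖ := B.le_opNorm₂ _ _
    _ ≤ ‖B‖ * (C * finL2 s c) * (C' * finL2 t d) := by
      gcongr
      · exact hx s c
      · exact hy t d
    _ = _ := by ring

end Operators

/-! ### Blocks with rapidly decreasing weights -/

/-- Lengths `n k` and weights `v k` of a sequence of blocks: the weights decrease fast, and each
length is large compared with the total length of the preceding blocks and with the powers of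
`1 / v k` that occur in the trace estimates. -/
structure IsBlockScale (p : ℝ) (n : ℕ → ℕ) (v : ℕ → ℝ) : Prop where
  card_pos : ∀ k, 0 < n k
  weight_pos : ∀ k, 0 < v k
  weight_le_one : ∀ k, v k ≤ 1
  weight_decay : ∀ k l : ℕ, k < l → v l * (k + 1) ≤ v k
  card_large : ∀ k : ℕ, (k + 1) * ((∑ l ∈ Finset.range k, n l : ℕ) : ℝ) ≤ n k * v k
  weight_large : ∀ k : ℕ, (k + 1 : ℝ) ≤ (n k : ℝ) ^ (1 / 2 - 1 / p) * v k

/-- Recursive choice of a sequence of which each term may be required to be large compared with the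
sum of the preceding ones. -/
lemma exists_seq_of_partial_sum {P : ℕ → ℕ → ℕ → Prop} (h : ∀ k R, ∃ n, P k R n) :
    ∃ n : ℕ → ℕ, ∀ k, P k (∑ l ∈ Finset.range k, n l) (n k) := by
  choose c hc using h
  let S : ℕ → ℕ := fun k => Nat.rec 0 (fun k R => R + c k R) k
  have hS : ∀ k, ∑ l ∈ Finset.range k, c l (S l) = S k := by
    intro k
    induction k with
    | zero => rfl
    | succ k ih => rw [Finset.sum_range_succ, ih]
  exact ⟨fun k => c k (S k), fun k => by rw [hS]; exact hc k _⟩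

lemma exists_isBlockScale {p : ℝ} (hp : 2 < p) : ∃ n v, IsBlockScale p n v := by
  have hθ : 0 < 1 / 2 - 1 / p := by
    rw [sub_pos]
    exact one_div_lt_one_div_of_lt (by norm_num) hp
  let v : ℕ → ℝ := fun k => 1 / ((k + 1).factorial : ℝ)
  have hv : ∀ k, 0 < v k := fun k => by positivity
  have hex : ∀ k R : ℕ, ∃ n : ℕ, 0 < n ∧ (k + 1) * (R : ℝ) ≤ n * v k ∧
      (k + 1 : ℝ) ≤ (n : ℝ) ^ (1 / 2 - 1 / p) * v k := by
    intro k R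
    have h1 : Tendsto (fun n : ℕ => (n : ℝ) * v k) atTop atTop :=
      tendsto_natCast_atTop_atTop.atTop_mul_const (hv k)
    have h2 : Tendsto (fun n : ℕ => (n : ℝ) ^ (1 / 2 - 1 / p) * v k) atTop atTop :=
      ((tendsto_rpow_atTop hθ).comp tendsto_natCast_atTop_atTop).atTop_mul_const (hv k)
    obtain ⟨n, hn⟩ := ((eventually_gt_atTop 0).and
      ((h1.eventually_ge_atTop _).and (h2.eventually_ge_atTop _))).exists
    exact ⟨n, hn⟩
  obtain ⟨n, hn⟩ := exists_seq_of_partial_sum hex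
  refine ⟨n, v, fun k => (hn k).1, hv, fun k => ?_, fun k l hkl => ?_, fun k => (hn k).2.1,
    fun k => (hn k).2.2⟩
  · exact div_le_one_of_le₀ (by exact_mod_cast Nat.one_le_iff_ne_zero.2 (Nat.factorial_ne_zero _))
      (by positivity)
  · have h1 : (k + 1) * (k + 1).factorial ≤ (l + 1).factorial :=
      calc (k + 1) * (k + 1).factorial ≤ (k + 1 + 1) * (k + 1).factorial := by gcongr; omega
        _ = (k + 1 + 1).factorial := (Nat.factorial_succ _).symm
        _ ≤ (l + 1).factorial := Nat.factorial_le (by omega)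
    have h2 : ((k : ℝ) + 1) * (k + 1).factorial ≤ (l + 1).factorial := by exact_mod_cast h1
    simp only [v]
    rw [div_mul_eq_mul_div, one_mul, div_le_div_iff₀ (by positivity) (by positivity), one_mul]
    exact h2

/-- The `k`-th block of indices, of length `n k`. -/
def block (n : ℕ → ℕ) (k : ℕ) : Finset (ℕ × ℕ) := {k} ×ˢ Finset.range (n k)

lemma mem_block {n : ℕ → ℕ} {k : ℕ} {i : ℕ × ℕ} : i ∈ block n k ↔ i.1 = k ∧ i.2 < n k := by
  simp only [block, Finset.mem_product, Finset.mem_singleton, Finset.mem_range]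

lemma card_block (n : ℕ → ℕ) (k : ℕ) : (block n k).card = n k := by simp [block]

section Blocks

variable {𝕜 E F Ω : Type*} [RCLike 𝕜] [NormedAddCommGroup E] [NormedSpace 𝕜 E]
  [NormedAddCommGroup F] [NormedSpace 𝕜 F]

/-- The trace over the block `k` against indices from other blocks is small compared with the length
`n k`. -/
lemma norm_block_trace_le [MeasurableSpace Ω] {μ : Measure Ω} [IsProbabilityMeasure μ]
    {p C D K : ℝ} {ε : ℕ × ℕ → Ω → ℝ} (hp : 2 < p) (hC : 0 ≤ C) (hD : 0 < D) (hK : 0 ≤ K)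
    (hε : IsKhintchine 𝕜 μ p K ε) {n : ℕ → ℕ} {v : ℕ → ℝ} (hnv : IsBlockScale p n v)
    {f : ℕ × ℕ → E} (hf : HasUpperEstimate (𝕜 := 𝕜) p C (fun i => v i.1) f)
    {h : ℕ × ℕ → E →L[𝕜] 𝕜}
    (hh : ∀ (s : Finset (ℕ × ℕ)) (c : ℕ × ℕ → 𝕜),
      ‖∑ i ∈ s, ((v i.1 : 𝕜) * c i) • h i‖ ≤ D * finL2 s c)
    {b : ℕ × ℕ → ℕ × ℕ → 𝕜} (hb : IsL2Bounded D b) (k : ℕ) {t : Finset (ℕ × ℕ)}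
    (ht : ∀ j ∈ t, j.1 ≠ k ∧ j.2 < n j.1) :
    ‖∑ i ∈ block n k, ∑ j ∈ t, b i j * h i (f j)‖ ≤
      n k * ((2 * C * D ^ 2 + D * C * (1 + K * D ^ p) + D ^ 2 * C) / (k + 1)) := by
  have hv := hnv.weight_pos k
  have hn : (0 : ℝ) < n k := by exact_mod_cast hnv.card_pos k
  have hk : (0 : ℝ) < k + 1 := by positivity
  have hhk : ∀ c : ℕ × ℕ → 𝕜, ‖∑ i ∈ block n k, c i • h i‖ ≤ D / v k * finL2 (block n k) c := by
    intro c
    have h1 : ∑ i ∈ block n k, c i • h i =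
        ∑ i ∈ block n k, ((v i.1 : 𝕜) * ((v k : 𝕜)⁻¹ * c i)) • h i := by
      refine Finset.sum_congr rfl fun i hi => ?_
      rw [(mem_block.1 hi).1, mul_inv_cancel_left₀]
      exact_mod_cast hv.ne'
    have h2 : finL2 (block n k) (fun i => (v k : 𝕜)⁻¹ * c i) =
        (v k)⁻¹ * finL2 (block n k) c := by
      rw [finL2, finL2]
      simp_rw [norm_mul, mul_pow]
      rw [← Finset.mul_sum, Real.sqrt_mul (by positivity), Real.sqrt_sq (norm_nonneg _), norm_inv,
        RCLike.norm_ofReal, abs_of_pos hv]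
    rw [h1]
    refine (hh _ _).trans (le_of_eq ?_)
    rw [h2]; ring
  have hsplit : ∑ i ∈ block n k, ∑ j ∈ t, b i j * h i (f j) =
      ∑ i ∈ block n k, ∑ j ∈ t with j.1 < k, b i j * h i (f j) +
        ∑ i ∈ block n k, ∑ j ∈ t with ¬ j.1 < k, b i j * h i (f j) := by
    rw [← Finset.sum_add_distrib]
    exact Finset.sum_congr rfl fun i _ => (Finset.sum_filter_add_sum_filter_not _ _ _).symm
  have hvle : ∀ i : ℕ × ℕ, 0 < v i.1 ∧ v i.1 ≤ 1 :=
    fun i => ⟨hnv.weight_pos _, hnv.weight_le_one _⟩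
  have hnear : ‖∑ i ∈ block n k, ∑ j ∈ t with j.1 < k, b i j * h i (f j)‖ ≤
      n k * (2 * C * D ^ 2 / (k + 1)) := by
    have hcard : ((t.filter fun j => j.1 < k).card : ℝ) ≤
        ((∑ l ∈ Finset.range k, n l : ℕ) : ℝ) := by
      have hsub : (t.filter fun j => j.1 < k) ⊆ (Finset.range k).biUnion (block n) := by
        intro j hj
        rw [Finset.mem_filter] at hj
        rw [Finset.mem_biUnion]
        exact ⟨j.1, Finset.mem_range.2 hj.2, mem_block.2 ⟨rfl, (ht j hj.1).2⟩⟩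
      have := (Finset.card_le_card hsub).trans Finset.card_biUnion_le
      simp_rw [card_block] at this
      exact_mod_cast this
    refine (norm_trace_near_le (M := 2 * C) hD.le (by positivity) hb hhk fun j _ => ?_).trans ?_
    · simpa [finL2] using norm_sum_smul_le_of_upper hp hC hvle hf {j} fun _ => 1
    · have h1 := hnv.card_large k
      calc _ ≤ ((∑ l ∈ Finset.range k, n l : ℕ) : ℝ) * (D / v k * D * (2 * C)) := by gcongr
        _ = ((k + 1) * ((∑ l ∈ Finset.range k, n l : ℕ) : ℝ)) *
            (D * D * (2 * C) / v k / (k + 1)) := by field_simp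
        _ ≤ (n k * v k) * (D * D * (2 * C) / v k / (k + 1)) := by gcongr
        _ = _ := by field_simp
  have hfar : ‖∑ i ∈ block n k, ∑ j ∈ t with ¬ j.1 < k, b i j * h i (f j)‖ ≤
      n k * ((D * C * (1 + K * D ^ p) + D ^ 2 * C) / (k + 1)) := by
    have hne : (block n k).Nonempty := by
      rw [← Finset.card_pos, card_block]; exact hnv.card_pos k
    refine (norm_trace_far_le hp hC hD (by positivity) hK hε hf hb hne hhk
      (v := v k / (k + 1)) (fun j hj => ?_) (by positivity)).trans ?_
    · rw [Finset.mem_filter] at hj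
      have hlt : k < j.1 := lt_of_le_of_ne (not_lt.1 hj.2) (ht j hj.1).1.symm
      rw [abs_of_pos (hvle j).1, le_div_iff₀ hk]
      exact hnv.weight_decay _ _ hlt
    · rw [card_block]
      have hsq : √(n k : ℝ) * √(n k : ℝ) = n k := Real.mul_self_sqrt hn.le
      -- This is where `p > 2` matters: `n ^ (1 / 2 + 1 / p)` is small compared with `n * v k`.
      have h1 : √(n k : ℝ) * (n k : ℝ) ^ (1 / p) / v k ≤ n k / (k + 1) := by
        rw [div_le_div_iff₀ hv hk]
        have h2 : √(n k : ℝ) * (n k : ℝ) ^ (1 / p) * (n k : ℝ) ^ (1 / 2 - 1 / p) = n k := by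
          rw [Real.sqrt_eq_rpow, ← Real.rpow_add hn, ← Real.rpow_add hn]
          norm_num
        calc √(n k : ℝ) * (n k : ℝ) ^ (1 / p) * (k + 1)
            ≤ √(n k : ℝ) * (n k : ℝ) ^ (1 / p) * ((n k : ℝ) ^ (1 / 2 - 1 / p) * v k) := by
              gcongr; exact hnv.weight_large k
          _ = (√(n k : ℝ) * (n k : ℝ) ^ (1 / p) * (n k : ℝ) ^ (1 / 2 - 1 / p)) * v k := by ring
          _ = n k * v k := by rw [h2]
      calc D / v k * √(n k : ℝ) *
            (C * ((n k : ℝ) ^ (1 / p) * (1 + K * D ^ p) + v k / (k + 1) * (D * √(n k : ℝ))))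
          = (√(n k : ℝ) * (n k : ℝ) ^ (1 / p) / v k) * (D * C * (1 + K * D ^ p)) +
            (√(n k : ℝ) * √(n k : ℝ)) / (k + 1) * (D ^ 2 * C) := by field_simp
        _ ≤ (n k / (k + 1)) * (D * C * (1 + K * D ^ p)) + n k / (k + 1) * (D ^ 2 * C) := by
          rw [hsq]; gcongr
        _ = _ := by ring
  rw [hsplit]
  refine (norm_add_le _ _).trans ((add_le_add hnear hfar).trans (le_of_eq ?_))
  ring

end Blocks

/-! ### Rosenthal pairs and the averaged functionals -/

section Pairs

variable {𝕜 E F : Type*} [RCLike 𝕜] [NormedAddCommGroup E] [NormedSpace 𝕜 E]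
  [NormedAddCommGroup F] [NormedSpace 𝕜 F]

/-- A biorthogonal pair of systems, with respect to the bilinear form `B`, such that `f` is
dominated by the norm of Rosenthal's space with weight `w`, `g` is bounded, and the system
`w i • g i` is dominated by the basis of `ℓ₂`. -/
structure IsRosenthalPair (B : E →L[𝕜] F →L[𝕜] 𝕜) (p C : ℝ) (w : ℕ × ℕ → ℝ)
    (f : ℕ × ℕ → E) (g : ℕ × ℕ → F) : Prop where
  pairing_self : ∀ i, B (f i) (g i) = 1
  pairing_ne : ∀ i j, i ≠ j → B (f i) (g j) = 0
  norm_le : ∀ i, ‖g i‖ ≤ C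
  upper : HasUpperEstimate (𝕜 := 𝕜) p C w f
  lower : ∀ (s : Finset (ℕ × ℕ)) (c : ℕ × ℕ → 𝕜),
    ‖∑ i ∈ s, ((w i : 𝕜) * c i) • g i‖ ≤ C * finL2 s c

/-- There are Rosenthal pairs for all weights with values in `(0, 1]`. The constant may depend on
the weight. -/
def HasRosenthalPairs (B : E →L[𝕜] F →L[𝕜] 𝕜) (p : ℝ) : Prop :=
  ∀ w : ℕ × ℕ → ℝ, (∀ i, 0 < w i ∧ w i ≤ 1) → ∃ C f g, IsRosenthalPair B p C w f g

lemma IsL2Bounded.mono {ι κ : Type*} {D D' : ℝ} {b : ι → κ → 𝕜} (hb : IsL2Bounded D b)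
    (h : D ≤ D') : IsL2Bounded D' b := fun s t c d => by
  have h1 := finL2_nonneg s c
  have h2 := finL2_nonneg t d
  exact (hb s t c d).trans (by gcongr)

lemma norm_sum_smul_operator_le {ι G : Type*} [NormedAddCommGroup G] [NormedSpace 𝕜 G]
    (L : E →L[𝕜] G) {C : ℝ} {x : ι → E} {u : ι → 𝕜}
    (hx : ∀ (s : Finset ι) (c : ι → 𝕜), ‖∑ i ∈ s, (u i * c i) • x i‖ ≤ C * finL2 s c)
    (s : Finset ι) (c : ι → 𝕜) :
    ‖∑ i ∈ s, (u i * c i) • L (x i)‖ ≤ ‖L‖ * C * finL2 s c := by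
  have h1 : ∑ i ∈ s, (u i * c i) • L (x i) = L (∑ i ∈ s, (u i * c i) • x i) := by
    simp [map_sum]
  rw [h1, mul_assoc]
  exact (L.le_opNorm _).trans (mul_le_mul_of_nonneg_left (hx s c) (norm_nonneg _))

lemma norm_sum_smul_operator_le' {ι G : Type*} [NormedAddCommGroup G] [NormedSpace 𝕜 G]
    (L : E →L[𝕜] G) {C : ℝ} {x : ι → E}
    (hx : ∀ (s : Finset ι) (c : ι → 𝕜), ‖∑ i ∈ s, c i • x i‖ ≤ C * finL2 s c)
    (s : Finset ι) (c : ι → 𝕜) :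
    ‖∑ i ∈ s, c i • L (x i)‖ ≤ ‖L‖ * C * finL2 s c := by
  simpa using norm_sum_smul_operator_le L (u := fun _ => 1) (by simpa using hx) s c

lemma norm_sum_indicator_smul_le {ι : Type*} {C : ℝ} (hC : 0 ≤ C) {x : ι → E}
    (hx : ∀ (s : Finset ι) (c : ι → 𝕜), ‖∑ i ∈ s, c i • x i‖ ≤ C * finL2 s c)
    (J : Set ι) (s : Finset ι) (c : ι → 𝕜) :
    ‖∑ i ∈ s, c i • J.indicator x i‖ ≤ C * finL2 s c := by
  classical
  have h1 : ∑ i ∈ s, c i • J.indicator x i = ∑ i ∈ s with i ∈ J, c i • x i := by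
    rw [Finset.sum_filter]
    refine Finset.sum_congr rfl fun i _ => ?_
    by_cases hi : i ∈ J <;> simp [hi]
  rw [h1]
  refine (hx _ _).trans (mul_le_mul_of_nonneg_left ?_ hC)
  exact Real.sqrt_le_sqrt (Finset.sum_le_sum_of_subset_of_nonneg (Finset.filter_subset _ _)
    fun _ _ _ => by positivity)

/-- The indices in the blocks `k ∈ α`. -/
def blockIndices (n : ℕ → ℕ) (α : Set ℕ) : Set (ℕ × ℕ) := {j | j.1 ∈ α ∧ j.2 < n j.1}

/-- Vectors set to zero outside `J` may be omitted from a trace. -/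
lemma sum_indicator_trace_eq {ι κ : Type*} (I : Finset ι) (J : Set κ) [DecidablePred (· ∈ J)]
    (s : Finset κ) (b : ι → κ → 𝕜) (h : ι → E →L[𝕜] 𝕜) (f : κ → E) :
    ∑ j ∈ s, ∑ i ∈ I, b i j * h i (J.indicator f j) =
      ∑ i ∈ I, ∑ j ∈ s with j ∈ J, b i j * h i (f j) := by
  rw [Finset.sum_comm]
  refine Finset.sum_congr rfl fun i _ => ?_
  rw [Finset.sum_filter]
  refine Finset.sum_congr rfl fun j _ => ?_
  by_cases hj : j ∈ J <;> simp [hj]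

lemma tendsto_of_norm_le_div {Φ : ℕ → 𝕜} {β : Set ℕ} {M : ℝ}
    (h : ∀ k, k ∉ β → ‖Φ k‖ ≤ M / (k + 1)) : Tendsto Φ (atTop ⊓ 𝓟 βᶜ) (𝓝 0) := by
  have h1 : Tendsto (fun k : ℕ => M / ((k : ℝ) + 1)) atTop (𝓝 0) :=
    tendsto_const_nhds.div_atTop (tendsto_natCast_atTop_atTop.atTop_add tendsto_const_nhds)
  refine squeeze_zero_norm' ?_ (h1.mono_left inf_le_left)
  filter_upwards [mem_inf_of_right (mem_principal_self _)] with k hk using h k hk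

/-- The functional `S ↦ φ i (S (x i))` averaged over the indices `i` of the `k`-th block. -/
def averageFunctional (n : ℕ → ℕ) (x : ℕ × ℕ → E) (φ : ℕ × ℕ → E →L[𝕜] 𝕜) (k : ℕ) :
    (E →L[𝕜] E) →+ 𝕜 where
  toFun S := (n k : 𝕜)⁻¹ * ∑ i ∈ block n k, φ i (S (x i))
  map_zero' := by simp
  map_add' S T := by simp [Finset.sum_add_distrib, mul_add]

lemma norm_averageFunctional_le {n : ℕ → ℕ} {x : ℕ × ℕ → E} {φ : ℕ × ℕ → E →L[𝕜] 𝕜}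
    {C C' : ℝ} (hx : ∀ i, ‖x i‖ ≤ C) (hφ : ∀ i, ‖φ i‖ ≤ C') (k : ℕ) (S : E →L[𝕜] E) :
    ‖averageFunctional n x φ k S‖ ≤ C' * C * ‖S‖ := by
  have hC : 0 ≤ C := (norm_nonneg _).trans (hx 0)
  have hC' : 0 ≤ C' := (norm_nonneg _).trans (hφ 0)
  change ‖(n k : 𝕜)⁻¹ * ∑ i ∈ block n k, φ i (S (x i))‖ ≤ _
  rw [norm_mul, norm_inv, RCLike.norm_natCast]
  rcases (n k).eq_zero_or_pos with h0 | h0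
  · rw [h0]; simp; positivity
  have hn : (0 : ℝ) < n k := by exact_mod_cast h0
  rw [inv_mul_le_iff₀ hn, ← card_block n k, ← nsmul_eq_mul]
  refine (norm_sum_le _ _).trans (Finset.sum_le_card_nsmul _ _ _ fun i _ => ?_)
  calc _ ≤ ‖φ i‖ * (‖S‖ * ‖x i‖) :=
        ((φ i).le_opNorm _).trans (mul_le_mul_of_nonneg_left (S.le_opNorm _) (norm_nonneg _))
    _ ≤ C' * (‖S‖ * C) := by gcongr; exacts [hφ i, hx i]
    _ = _ := by ring

lemma averageFunctional_eq_one {n : ℕ → ℕ} {x : ℕ × ℕ → E} {φ : ℕ × ℕ → E →L[𝕜] 𝕜} {k : ℕ}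
    (hn : 0 < n k) {S : E →L[𝕜] E} (h : ∀ i ∈ block n k, φ i (S (x i)) = 1) :
    averageFunctional n x φ k S = 1 := by
  change (n k : 𝕜)⁻¹ * ∑ i ∈ block n k, φ i (S (x i)) = 1
  rw [Finset.sum_congr rfl h, Finset.sum_const, card_block, nsmul_eq_mul, mul_one]
  exact inv_mul_cancel₀ (by exact_mod_cast hn.ne')

lemma norm_averageFunctional_le_of_hasSum {n : ℕ → ℕ} {x : ℕ × ℕ → E} {φ : ℕ × ℕ → E →L[𝕜] 𝕜}
    {k : ℕ} (hn : 0 < n k) {S : E →L[𝕜] E} {τ : ℕ × ℕ → ℕ × ℕ → 𝕜} {M : ℝ}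
    (hS : ∀ i ∈ block n k, HasSum (τ i) (φ i (S (x i))))
    (hM : ∀ s : Finset (ℕ × ℕ), ‖∑ j ∈ s, ∑ i ∈ block n k, τ i j‖ ≤ n k * M) :
    ‖averageFunctional n x φ k S‖ ≤ M := by
  have hn' : (0 : ℝ) < n k := by exact_mod_cast hn
  change ‖(n k : 𝕜)⁻¹ * ∑ i ∈ block n k, φ i (S (x i))‖ ≤ _
  rw [norm_mul, norm_inv, RCLike.norm_natCast, inv_mul_le_iff₀ hn']
  exact le_of_tendsto (hasSum_sum hS).norm (Eventually.of_forall hM)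

end Pairs

/-! ### Families of closed ideals from Rosenthal pairs -/

section Families

variable {𝕜 E F Ω : Type*} [RCLike 𝕜] [NormedAddCommGroup E] [NormedSpace 𝕜 E]
  [NormedAddCommGroup F] [NormedSpace 𝕜 F] [MeasurableSpace Ω] {μ : Measure Ω}
  [IsProbabilityMeasure μ] {p K : ℝ} {ε : ℕ × ℕ → Ω → ℝ}

/-- Closed ideals in the algebra of the first space of the duality: the operators map `x j` to
`f j`. -/
theorem exists_closedIdeals_family_left [CompleteSpace E] (hp : 2 < p)
    (hε : IsKhintchine 𝕜 μ p K ε) (hK : 0 ≤ K) {B : E →L[𝕜] F →L[𝕜] 𝕜}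
    (hB : HasRosenthalPairs B p) :
    ∃ J : Set ℝ ↪o TwoSidedIdeal (E →L[𝕜] E), ∀ s, J s ∈ closedIdeals (E →L[𝕜] E) := by
  classical
  obtain ⟨n, v, hnv⟩ := exists_isBlockScale hp
  have hvle : ∀ i : ℕ × ℕ, 0 < v i.1 ∧ v i.1 ≤ 1 :=
    fun i => ⟨hnv.weight_pos _, hnv.weight_le_one _⟩
  -- Constant weight `1` gives a pair `x`, `y` of systems that are both dominated by `ℓ₂`.
  obtain ⟨C₁, x, y, hxy⟩ := hB (fun _ => 1) fun _ => ⟨one_pos, le_rfl⟩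
  obtain ⟨C, f, g, hfg⟩ := hB (fun i => v i.1) hvle
  have hC₁ : 0 ≤ C₁ := (norm_nonneg _).trans (hxy.norm_le 0)
  have hC : 0 ≤ C := (norm_nonneg _).trans (hfg.norm_le 0)
  have hx := norm_sum_smul_le_of_upper hp hC₁ (fun _ => ⟨one_pos, le_rfl⟩) hxy.upper
  have hy : ∀ (s : Finset (ℕ × ℕ)) (c : ℕ × ℕ → 𝕜), ‖∑ i ∈ s, c i • y i‖ ≤ C₁ * finL2 s c := by
    simpa using hxy.lower
  have hf := norm_sum_smul_le_of_upper hp hC hvle hfg.upper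
  have hT : ∀ α : Set ℕ, ∃ T : E →L[𝕜] E, ∀ z,
      HasSum (fun j => B.flip (y j) z • (blockIndices n α).indicator f j) (T z) := fun α =>
    exists_hasSum_operator (by positivity) (by positivity)
      (norm_sum_smul_operator_le' B.flip hy)
      (norm_sum_indicator_smul_le (by positivity) hf (blockIndices n α))
  choose T hT using hT
  refine exists_closedIdeals_family T (averageFunctional n x fun i => B.flip (g i))
    (norm_averageFunctional_le (C := 2 * C₁) (C' := ‖B‖ * C) (fun i => ?_) fun i => ?_) ?_ ?_
  · simpa [finL2] using hx {i} fun _ => 1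
  · refine (B.flip.le_opNorm _).trans ?_
    rw [ContinuousLinearMap.opNorm_flip]
    gcongr
    exact hfg.norm_le i
  · intro α k hk
    refine averageFunctional_eq_one (hnv.card_pos k) fun i hi => ?_
    have hi' : i ∈ blockIndices n α := by
      rw [mem_block] at hi
      exact ⟨hi.1 ▸ hk, hi.1 ▸ hi.2⟩
    have hTx : T α (x i) = f i := by
      refine (hT α (x i)).unique ?_
      convert hasSum_single i fun j hj => ?_ using 1
      · simp [hxy.pairing_self, hi']
      · simp [hxy.pairing_ne i j hj.symm]
    rw [hTx]
    exact hfg.pairing_self i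
  · intro β a a'
    set D := ‖B‖ * (‖a'‖ * (2 * C₁)) * C₁ + ‖B.flip‖ * C * ‖a‖ + 1 with hD
    have hDpos : 0 < D := by positivity
    refine tendsto_of_norm_le_div
      (M := 2 * C * D ^ 2 + D * C * (1 + K * D ^ p) + D ^ 2 * C) fun k hk => ?_
    have hb : IsL2Bounded D fun i j => B (a' (x i)) (y j) :=
      (isL2Bounded_pairing B (by positivity) (norm_sum_smul_operator_le' a' hx) hy).mono (by
        have : 0 ≤ ‖B.flip‖ * C * ‖a‖ := by positivity
        rw [hD]; linarith)
    let L : F →L[𝕜] E →L[𝕜] 𝕜 := (ContinuousLinearMap.compL 𝕜 E E 𝕜).flip a ∘L B.flip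
    have hL : ‖L‖ * C ≤ D := by
      have h1 : ‖L‖ ≤ ‖B.flip‖ * ‖a‖ := by
        refine L.opNorm_le_bound (by positivity) fun z => ?_
        refine (ContinuousLinearMap.opNorm_comp_le (B.flip z) a).trans ?_
        calc _ ≤ ‖B.flip‖ * ‖z‖ * ‖a‖ := by gcongr; exact B.flip.le_opNorm z
          _ = _ := by ring
      have h2 : 0 ≤ ‖B‖ * (‖a'‖ * (2 * C₁)) * C₁ := by positivity
      calc _ ≤ ‖B.flip‖ * ‖a‖ * C := by gcongr
        _ ≤ D := by rw [hD]; linarith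
    refine norm_averageFunctional_le_of_hasSum (hnv.card_pos k)
      (τ := fun i j => B (a' (x i)) (y j) * L (g i) ((blockIndices n β).indicator f j))
      (fun i _ => ?_) fun s => ?_
    · have := (hT β (a' (x i))).mapL (L (g i))
      simp only [map_smul, smul_eq_mul] at this
      exact this
    · rw [sum_indicator_trace_eq]
      refine norm_block_trace_le hp hC hDpos hK hε hnv hfg.upper (fun s c => ?_) hb k ?_
      · refine (norm_sum_smul_operator_le L hfg.lower s c).trans ?_
        exact mul_le_mul_of_nonneg_right hL (finL2_nonneg _ _)
      · intro j hj
        have := (Finset.mem_filter.1 hj).2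
        exact ⟨fun h => hk (h ▸ this.1), this.2⟩

/-- Closed ideals in the algebra of the second space of the duality: the operators map `g j` to
`y j`. -/
theorem exists_closedIdeals_family_right [CompleteSpace F] (hp : 2 < p)
    (hε : IsKhintchine 𝕜 μ p K ε) (hK : 0 ≤ K) {B : E →L[𝕜] F →L[𝕜] 𝕜}
    (hB : HasRosenthalPairs B p) :
    ∃ J : Set ℝ ↪o TwoSidedIdeal (F →L[𝕜] F), ∀ s, J s ∈ closedIdeals (F →L[𝕜] F) := by
  classical
  obtain ⟨n, v, hnv⟩ := exists_isBlockScale hp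
  have hvle : ∀ i : ℕ × ℕ, 0 < v i.1 ∧ v i.1 ≤ 1 :=
    fun i => ⟨hnv.weight_pos _, hnv.weight_le_one _⟩
  -- Constant weight `1` gives a pair `x`, `y` of systems that are both dominated by `ℓ₂`.
  obtain ⟨C₁, x, y, hxy⟩ := hB (fun _ => 1) fun _ => ⟨one_pos, le_rfl⟩
  obtain ⟨C, f, g, hfg⟩ := hB (fun i => v i.1) hvle
  have hC₁ : 0 ≤ C₁ := (norm_nonneg _).trans (hxy.norm_le 0)
  have hC : 0 ≤ C := (norm_nonneg _).trans (hfg.norm_le 0)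
  have hx := norm_sum_smul_le_of_upper hp hC₁ (fun _ => ⟨one_pos, le_rfl⟩) hxy.upper
  have hy : ∀ (s : Finset (ℕ × ℕ)) (c : ℕ × ℕ → 𝕜), ‖∑ i ∈ s, c i • y i‖ ≤ C₁ * finL2 s c := by
    simpa using hxy.lower
  have hf := norm_sum_smul_le_of_upper hp hC hvle hfg.upper
  have hT : ∀ α : Set ℕ, ∃ T : F →L[𝕜] F, ∀ z,
      HasSum (fun j => B ((blockIndices n α).indicator f j) z • y j) (T z) := fun α =>
    exists_hasSum_operator (φ := fun j => B ((blockIndices n α).indicator f j))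
      (by positivity) (by positivity)
      (norm_sum_smul_operator_le' B
        (norm_sum_indicator_smul_le (by positivity) hf (blockIndices n α))) hy
  choose T hT using hT
  refine exists_closedIdeals_family T (averageFunctional n g fun i => B (x i))
    (norm_averageFunctional_le (C := C) (C' := ‖B‖ * (2 * C₁)) hfg.norm_le fun i => ?_) ?_ ?_
  · refine (B.le_opNorm _).trans (mul_le_mul_of_nonneg_left ?_ (norm_nonneg _))
    simpa [finL2] using hx {i} fun _ => 1
  · intro α k hk
    refine averageFunctional_eq_one (hnv.card_pos k) fun i hi => ?_
    have hi' : i ∈ blockIndices n α := by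
      rw [mem_block] at hi
      exact ⟨hi.1 ▸ hk, hi.1 ▸ hi.2⟩
    have hTg : T α (g i) = y i := by
      refine (hT α (g i)).unique ?_
      convert hasSum_single i fun j hj => ?_ using 1
      · simp [hfg.pairing_self, hi']
      · by_cases hj' : j ∈ blockIndices n α
        · simp [hj', hfg.pairing_ne j i hj]
        · simp [hj']
    rw [hTg]
    exact hxy.pairing_self i
  · intro β a a'
    set D := ‖B‖ * (2 * C₁) * (‖a‖ * C₁) + ‖B.flip‖ * ‖a'‖ * C + 1 with hD
    have hDpos : 0 < D := by positivity
    refine tendsto_of_norm_le_div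
      (M := 2 * C * D ^ 2 + D * C * (1 + K * D ^ p) + D ^ 2 * C) fun k hk => ?_
    have hb : IsL2Bounded D fun i j => B (x i) (a (y j)) :=
      (isL2Bounded_pairing B (by positivity) hx (norm_sum_smul_operator_le' a hy)).mono (by
        have : 0 ≤ ‖B.flip‖ * ‖a'‖ * C := by positivity
        rw [hD]; linarith)
    let L : F →L[𝕜] E →L[𝕜] 𝕜 := B.flip ∘L a'
    have hL : ‖L‖ * C ≤ D := by
      have h1 : ‖L‖ ≤ ‖B.flip‖ * ‖a'‖ := ContinuousLinearMap.opNorm_comp_le _ _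
      have h2 : 0 ≤ ‖B‖ * (2 * C₁) * (‖a‖ * C₁) := by positivity
      calc _ ≤ ‖B.flip‖ * ‖a'‖ * C := by gcongr
        _ ≤ D := by rw [hD]; linarith
    refine norm_averageFunctional_le_of_hasSum (hnv.card_pos k)
      (τ := fun i j => B (x i) (a (y j)) * L (g i) ((blockIndices n β).indicator f j))
      (fun i _ => ?_) fun s => ?_
    · have := (hT β (a' (g i))).mapL (B (x i) ∘L a)
      simpa [mul_comm, L] using this
    · rw [sum_indicator_trace_eq]
      refine norm_block_trace_le hp hC hDpos hK hε hnv hfg.upper (fun s c => ?_) hb k ?_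
      · refine (norm_sum_smul_operator_le L hfg.lower s c).trans ?_
        exact mul_le_mul_of_nonneg_right hL (finL2_nonneg _ _)
      · intro j hj
        have := (Finset.mem_filter.1 hj).2
        exact ⟨fun h => hk (h ▸ this.1), this.2⟩

end Families

/-! ### A smoothness inequality for `|z| ^ p` -/

section Smoothness

variable {𝕜 : Type*} [RCLike 𝕜]

/-- Convexity of the exponential function between `0` and `κ`, in a slightly weakened form. -/
lemma exp_mul_le_one_add {κ t : ℝ} (h0 : 0 ≤ t) (h1 : t ≤ 1) :
    Real.exp (κ * t) ≤ 1 + Real.exp κ * t := by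
  have h := convexOn_exp.2 (mem_univ 0) (mem_univ κ) (sub_nonneg.2 h1) h0 (by ring)
  simp only [smul_eq_mul, mul_zero, zero_add, Real.exp_zero, mul_one] at h
  rw [mul_comm κ t]
  nlinarith

lemma norm_one_add_rpow_le {p : ℝ} (hp : 0 ≤ p) (y : 𝕜) :
    ‖1 + y‖ ^ p ≤ Real.exp (p * RCLike.re y + p / 2 * ‖y‖ ^ 2) := by
  have h1 : ‖1 + y‖ ^ 2 ≤ Real.exp (2 * RCLike.re y + ‖y‖ ^ 2) := by
    have h2 : ‖1 + y‖ ^ 2 = 2 * RCLike.re y + ‖y‖ ^ 2 + 1 := by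
      simp only [RCLike.norm_sq_eq_def, map_add, RCLike.one_re, RCLike.one_im]
      ring
    rw [h2]
    exact Real.add_one_le_exp _
  have h3 : ‖1 + y‖ ^ p = (‖1 + y‖ ^ 2) ^ (p / 2) := by
    rw [← Real.rpow_natCast, ← Real.rpow_mul (norm_nonneg _)]
    congr 1; push_cast; ring
  rw [h3]
  calc _ ≤ Real.exp (2 * RCLike.re y + ‖y‖ ^ 2) ^ (p / 2) := by gcongr
    _ = _ := by rw [← Real.exp_mul]; congr 1; ring

lemma average_norm_one_add_rpow_le {p : ℝ} (hp : 0 ≤ p) {y : 𝕜} (hy : ‖y‖ ≤ 1) :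
    (‖1 + y‖ ^ p + ‖1 - y‖ ^ p) / 2 ≤ 1 + Real.exp (p / 2 + p ^ 2 / 2) * ‖y‖ ^ 2 := by
  have h1 := norm_one_add_rpow_le hp y
  have h2 := norm_one_add_rpow_le hp (-y)
  rw [← sub_eq_add_neg, norm_neg, map_neg] at h2
  have h3 := Real.cosh_le_exp_half_sq (p * RCLike.re y)
  rw [Real.cosh_eq] at h3
  have hre : (RCLike.re y) ^ 2 ≤ ‖y‖ ^ 2 := by
    rw [← sq_abs]; have := RCLike.abs_re_le_norm y; gcongr
  calc (‖1 + y‖ ^ p + ‖1 - y‖ ^ p) / 2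
      ≤ (Real.exp (p * RCLike.re y + p / 2 * ‖y‖ ^ 2) +
          Real.exp (p * -RCLike.re y + p / 2 * ‖y‖ ^ 2)) / 2 := by gcongr
    _ = Real.exp (p / 2 * ‖y‖ ^ 2) *
          ((Real.exp (p * RCLike.re y) + Real.exp (-(p * RCLike.re y))) / 2) := by
        rw [Real.exp_add, Real.exp_add, mul_neg]; ring
    _ ≤ Real.exp (p / 2 * ‖y‖ ^ 2) * Real.exp ((p * RCLike.re y) ^ 2 / 2) := by gcongr
    _ = Real.exp (p / 2 * ‖y‖ ^ 2 + (p * RCLike.re y) ^ 2 / 2) := by rw [Real.exp_add]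
    _ ≤ Real.exp ((p / 2 + p ^ 2 / 2) * ‖y‖ ^ 2) := by
        rw [Real.exp_le_exp, mul_pow]
        nlinarith [sq_nonneg p]
    _ ≤ _ := exp_mul_le_one_add (by positivity) (by
        have := norm_nonneg y
        exact pow_le_one₀ this hy)

/-- A constant for which `average_norm_add_rpow_le` holds; it is not optimal. -/
noncomputable def smoothnessConst (p : ℝ) : ℝ := Real.exp (p / 2 + p ^ 2 / 2)

/-- Averaging over a sign removes the term of first order in `x`. The last summand accounts for the
case `‖z‖ ≤ ‖x‖`. -/
lemma average_norm_add_rpow_le {p : ℝ} (hp : 2 < p) (z x : 𝕜) :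
    (‖z + x‖ ^ p + ‖z - x‖ ^ p) / 2 ≤
      ‖z‖ ^ p + smoothnessConst p * ‖x‖ ^ 2 * ‖z‖ ^ (p - 2) + 2 ^ p * ‖x‖ ^ p := by
  have hp0 : 0 ≤ p := by linarith
  have hK : 0 < smoothnessConst p := Real.exp_pos _
  rcases le_or_gt ‖z‖ ‖x‖ with h | h
  · have h1 : ‖z + x‖ ^ p ≤ (2 * ‖x‖) ^ p :=
      Real.rpow_le_rpow (norm_nonneg _) ((norm_add_le _ _).trans (by linarith)) hp0
    have h2 : ‖z - x‖ ^ p ≤ (2 * ‖x‖) ^ p :=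
      Real.rpow_le_rpow (norm_nonneg _) ((norm_sub_le _ _).trans (by linarith)) hp0
    rw [Real.mul_rpow (by norm_num) (norm_nonneg _)] at h1 h2
    have h3 : 0 ≤ ‖z‖ ^ p := by positivity
    have h4 : 0 ≤ smoothnessConst p * ‖x‖ ^ 2 * ‖z‖ ^ (p - 2) := by positivity
    linarith
  · have hz : 0 < ‖z‖ := (norm_nonneg _).trans_lt h
    have hz0 : z ≠ 0 := norm_pos_iff.1 hz
    have hy : ‖x / z‖ ≤ 1 := by rw [norm_div, div_le_one hz]; exact h.le
    have h1 := average_norm_one_add_rpow_le hp0 hy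
    have h2 : ‖z + x‖ = ‖z‖ * ‖1 + x / z‖ := by rw [← norm_mul]; congr 1; field_simp
    have h3 : ‖z - x‖ = ‖z‖ * ‖1 - x / z‖ := by rw [← norm_mul]; congr 1; field_simp
    have h4 : ‖z‖ ^ p = ‖z‖ ^ (p - 2) * ‖z‖ ^ 2 := by
      rw [← Real.rpow_natCast, ← Real.rpow_add hz]; norm_num
    rw [h2, h3, Real.mul_rpow hz.le (norm_nonneg _), Real.mul_rpow hz.le (norm_nonneg _)]
    calc (‖z‖ ^ p * ‖1 + x / z‖ ^ p + ‖z‖ ^ p * ‖1 - x / z‖ ^ p) / 2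
        = ‖z‖ ^ p * ((‖1 + x / z‖ ^ p + ‖1 - x / z‖ ^ p) / 2) := by ring
      _ ≤ ‖z‖ ^ p * (1 + smoothnessConst p * ‖x / z‖ ^ 2) := by
          gcongr; exact h1
      _ = ‖z‖ ^ p + smoothnessConst p * ‖x‖ ^ 2 * ‖z‖ ^ (p - 2) := by
          rw [norm_div, div_pow, h4]; field_simp
      _ ≤ _ := le_add_of_nonneg_right (by positivity)

end Smoothness

/-! ### Rosenthal's inequality for independent three-valued variables -/

section ThreePoint

/-- The law on `Fin 3` that gives mass `δ / 2` to each of `1` and `2`, and the remaining mass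
`1 - δ` to `0`. -/
noncomputable def threePoint (δ : ℝ) : Measure (Fin 3) :=
  ENNReal.ofReal (1 - δ) • Measure.dirac 0 +
    (ENNReal.ofReal (δ / 2) • Measure.dirac 1 + ENNReal.ofReal (δ / 2) • Measure.dirac 2)

/-- The values `0`, `1`, `-1` at the points `0`, `1`, `2`; a symmetric variable under
`threePoint δ`. -/
def threeSign : Fin 3 → ℝ := ![0, 1, -1]

lemma abs_threeSign_le (v : Fin 3) : |threeSign v| ≤ 1 := by
  fin_cases v <;> simp [threeSign]

lemma isProbabilityMeasure_threePoint {δ : ℝ} (h0 : 0 ≤ δ) (h1 : δ ≤ 1) :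
    IsProbabilityMeasure (threePoint δ) := by
  constructor
  simp only [threePoint, Measure.add_apply, Measure.smul_apply, measure_univ, smul_eq_mul, mul_one]
  rw [← ENNReal.ofReal_add (by linarith) (by linarith),
    ← ENNReal.ofReal_add (by linarith) (by linarith)]
  simp

lemma integral_threePoint {δ : ℝ} (h0 : 0 ≤ δ) (h1 : δ ≤ 1) (g : Fin 3 → ℝ) :
    ∫ v, g v ∂(threePoint δ) = (1 - δ) * g 0 + δ * ((g 1 + g 2) / 2) := by
  have hi : ∀ v : Fin 3, ∀ r : ℝ, Integrable g (ENNReal.ofReal r • Measure.dirac v) :=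
    fun v r => (integrable_dirac (by simp)).smul_measure ENNReal.ofReal_ne_top
  rw [threePoint, integral_add_measure (hi _ _) ((hi _ _).add_measure (hi _ _)),
    integral_add_measure (hi _ _) (hi _ _)]
  simp only [integral_smul_measure, integral_dirac, smul_eq_mul]
  rw [ENNReal.toReal_ofReal (by linarith), ENNReal.toReal_ofReal (by linarith)]
  ring

variable {𝕜 Ω : Type*} [RCLike 𝕜] [MeasurableSpace Ω] {μ : Measure Ω} [IsProbabilityMeasure μ]

lemma integrable_norm_rpow_of_bounded {S : Ω → 𝕜} (hS : Measurable S) {M : ℝ}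
    (hM : ∀ ω, ‖S ω‖ ≤ M) {r : ℝ} (hr : 0 ≤ r) : Integrable (fun ω => ‖S ω‖ ^ r) μ := by
  refine Integrable.of_bound (hS.norm.pow_const r).aestronglyMeasurable (M ^ r)
    (ae_of_all _ fun ω => ?_)
  rw [Real.norm_of_nonneg (by positivity)]
  exact Real.rpow_le_rpow (norm_nonneg _) (hM ω) hr

/-- The effect on the `p`-th moment of adding one independent symmetric variable. -/
lemma integral_norm_add_rpow_le {p δ : ℝ} (hp : 2 < p) (h0 : 0 ≤ δ) (h1 : δ ≤ 1) {S : Ω → 𝕜}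
    {T : Ω → Fin 3} (hS : Measurable S) {M : ℝ} (hM : ∀ ω, ‖S ω‖ ≤ M) (hT : Measurable T)
    (hST : S ⟂ᵢ[μ] T) (hlaw : μ.map T = threePoint δ) (a : 𝕜) :
    ∫ ω, ‖S ω + (threeSign (T ω) : 𝕜) * a‖ ^ p ∂μ ≤ ∫ ω, ‖S ω‖ ^ p ∂μ +
      smoothnessConst p * (δ * ‖a‖ ^ 2) * ∫ ω, ‖S ω‖ ^ (p - 2) ∂μ + 2 ^ p * (δ * ‖a‖ ^ p) := by
  have := isProbabilityMeasure_threePoint h0 h1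
  have hPS : IsProbabilityMeasure (μ.map S) := Measure.isProbabilityMeasure_map hS.aemeasurable
  let G : 𝕜 × Fin 3 → ℝ := fun q => ‖q.1 + (threeSign q.2 : 𝕜) * a‖ ^ p
  have hsgn : Measurable fun q : 𝕜 × Fin 3 => (threeSign q.2 : 𝕜) :=
    RCLike.measurable_ofReal.comp ((measurable_of_finite threeSign).comp measurable_snd)
  have hG : Measurable G := ((measurable_fst.add (hsgn.mul_const a)).norm).pow_const p
  have hprod : μ.map (fun ω => (S ω, T ω)) = (μ.map S).prod (threePoint δ) := by
    rw [(indepFun_iff_map_prod_eq_prod_map_map hS.aemeasurable hT.aemeasurable).1 hST, hlaw]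
  have hSTm : Measurable fun ω => (S ω, T ω) := hS.prodMk hT
  have hbd : ∀ ω, ‖S ω + (threeSign (T ω) : 𝕜) * a‖ ≤ M + ‖a‖ := by
    intro ω
    refine (norm_add_le _ _).trans (add_le_add (hM ω) ?_)
    rw [norm_mul, RCLike.norm_ofReal]
    exact mul_le_of_le_one_left (norm_nonneg _) (abs_threeSign_le _)
  have hGint : Integrable G ((μ.map S).prod (threePoint δ)) := by
    rw [← hprod, integrable_map_measure hG.aestronglyMeasurable hSTm.aemeasurable]
    exact integrable_norm_rpow_of_bounded
      (S := fun ω => S ω + (threeSign (T ω) : 𝕜) * a)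
      (hS.add ((RCLike.measurable_ofReal.comp
        ((measurable_of_finite threeSign).comp hT)).mul_const a)) hbd (by linarith)
  have hp0 : 0 ≤ p := by linarith
  have hp2 : 0 ≤ p - 2 := by linarith
  calc ∫ ω, ‖S ω + (threeSign (T ω) : 𝕜) * a‖ ^ p ∂μ
      = ∫ q, G q ∂((μ.map S).prod (threePoint δ)) := by
        rw [← hprod, integral_map hSTm.aemeasurable hG.aestronglyMeasurable]
    _ = ∫ z, ∫ v, G (z, v) ∂(threePoint δ) ∂(μ.map S) := integral_prod _ hGint
    _ = ∫ ω, ∫ v, G (S ω, v) ∂(threePoint δ) ∂μ := by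
        rw [integral_map hS.aemeasurable]
        exact (hG.stronglyMeasurable.integral_prod_right').aestronglyMeasurable
    _ ≤ ∫ ω, (‖S ω‖ ^ p + smoothnessConst p * (δ * ‖a‖ ^ 2) * ‖S ω‖ ^ (p - 2) +
          2 ^ p * (δ * ‖a‖ ^ p)) ∂μ := by
        refine integral_mono_of_nonneg (ae_of_all _ fun ω => ?_) ?_ (ae_of_all _ fun ω => ?_)
        · exact integral_nonneg fun v => by positivity
        · exact ((integrable_norm_rpow_of_bounded hS hM hp0).add
            ((integrable_norm_rpow_of_bounded hS hM hp2).const_mul _)).add (integrable_const _)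
        · simp only
          rw [integral_threePoint h0 h1]
          have h := average_norm_add_rpow_le hp (S ω) a
          simp only [G, threeSign, Matrix.cons_val_zero, Matrix.cons_val_one, Matrix.cons_val,
            RCLike.ofReal_zero, RCLike.ofReal_one, RCLike.ofReal_neg, zero_mul, one_mul, neg_mul,
            add_zero, ← sub_eq_add_neg]
          nlinarith
    _ = _ := by
        have hI₁ := integrable_norm_rpow_of_bounded (μ := μ) hS hM hp0
        have hI₂ := integrable_norm_rpow_of_bounded (μ := μ) hS hM hp2
        rw [integral_add (by fun_prop) (by fun_prop), integral_add (by fun_prop) (by fun_prop),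
          integral_const_mul]
        simp

variable {ι : Type*}

/-- Rosenthal's inequality for small coefficients, from which the general case follows by scaling.
The smallness keeps the `p`-th moments of the partial sums below `1`, so that the increments given
by `integral_norm_add_rpow_le` simply add up. -/
lemma integral_norm_sum_rpow_le {p : ℝ} (hp : 2 < p) {δ : ι → ℝ} (h0 : ∀ i, 0 ≤ δ i)
    (h1 : ∀ i, δ i ≤ 1) {T : ι → Ω → Fin 3} (hT : ∀ i, Measurable (T i)) (hind : iIndepFun T μ)
    (hlaw : ∀ i, μ.map (T i) = threePoint (δ i)) (a : ι → 𝕜) (s : Finset ι)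
    (h2 : smoothnessConst p * ∑ i ∈ s, δ i * ‖a i‖ ^ 2 ≤ 1 / 4)
    (hpp : 2 ^ p * ∑ i ∈ s, δ i * ‖a i‖ ^ p ≤ 1 / 2) :
    ∫ ω, ‖∑ i ∈ s, (threeSign (T i ω) : 𝕜) * a i‖ ^ p ∂μ ≤
      2 * (smoothnessConst p * ∑ i ∈ s, δ i * ‖a i‖ ^ 2) +
        2 ^ p * ∑ i ∈ s, δ i * ‖a i‖ ^ p := by
  classical
  have hK : 0 < smoothnessConst p := Real.exp_pos _
  induction s using Finset.induction_on with
  | empty =>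
    have : p ≠ 0 := by linarith
    simp [Real.zero_rpow this]
  | insert i s hi ih =>
    rw [Finset.sum_insert hi] at h2 hpp ⊢
    have hi2 : 0 ≤ smoothnessConst p * (δ i * ‖a i‖ ^ 2) :=
      mul_nonneg hK.le (mul_nonneg (h0 i) (by positivity))
    have hip : 0 ≤ 2 ^ p * (δ i * ‖a i‖ ^ p) :=
      mul_nonneg (by positivity) (mul_nonneg (h0 i) (by positivity))
    rw [mul_add] at h2 hpp
    specialize ih (by linarith) (by linarith)
    let Y : ι → Ω → 𝕜 := fun j ω => (threeSign (T j ω) : 𝕜) * a j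
    let S : Ω → 𝕜 := fun ω => ∑ j ∈ s, Y j ω
    have hYm : ∀ j, Measurable (Y j) := fun j =>
      (RCLike.measurable_ofReal.comp ((measurable_of_finite threeSign).comp (hT j))).mul_const _
    have hS : Measurable S := Finset.measurable_sum _ fun j _ => hYm j
    have hM : ∀ ω, ‖S ω‖ ≤ ∑ j ∈ s, ‖a j‖ := fun ω => by
      refine (norm_sum_le _ _).trans (Finset.sum_le_sum fun j _ => ?_)
      rw [norm_mul, RCLike.norm_ofReal]
      exact mul_le_of_le_one_left (norm_nonneg _) (abs_threeSign_le _)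
    have hST : S ⟂ᵢ[μ] T i := by
      have h := hind.indepFun_finset s {i} (Finset.disjoint_singleton_right.2 hi) hT
      exact h.comp (φ := fun q : (j : s) → Fin 3 => ∑ j : s, (threeSign (q j) : 𝕜) * a j)
        (ψ := fun q : (j : ({i} : Finset ι)) → Fin 3 => q ⟨i, Finset.mem_singleton_self i⟩)
        (measurable_of_finite _) (measurable_of_finite _) |>.congr
        (ae_of_all _ fun ω => by
          simp only [Function.comp, S, Y]
          exact Finset.sum_coe_sort s fun j => (threeSign (T j ω) : 𝕜) * a j)
        (ae_of_all _ fun ω => rfl)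
    have hstep := integral_norm_add_rpow_le hp (h0 i) (h1 i) hS hM (hT i) hST (hlaw i) (a i)
    have hle1 : ∫ ω, ‖S ω‖ ^ p ∂μ ≤ 1 := ih.trans (by linarith)
    have hp0 : 0 ≤ p := by linarith
    have hp2 : 0 ≤ p - 2 := by linarith
    have hle2 : ∫ ω, ‖S ω‖ ^ (p - 2) ∂μ ≤ 2 := by
      have hmono : ∫ ω, ‖S ω‖ ^ (p - 2) ∂μ ≤ ∫ ω, (‖S ω‖ ^ p + 1) ∂μ := by
        refine integral_mono (integrable_norm_rpow_of_bounded hS hM hp2)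
          ((integrable_norm_rpow_of_bounded hS hM hp0).add (integrable_const _)) fun ω => ?_
        simp only
        rcases le_total ‖S ω‖ 1 with h | h
        · have := Real.rpow_le_one (norm_nonneg (S ω)) h hp2
          have h' : 0 ≤ ‖S ω‖ ^ p := by positivity
          linarith
        · have := Real.rpow_le_rpow_of_exponent_le h (show p - 2 ≤ p by linarith)
          linarith
      rw [integral_add (integrable_norm_rpow_of_bounded hS hM hp0) (integrable_const _)] at hmono
      simp only [integral_const, probReal_univ, smul_eq_mul, mul_one] at hmono
      linarith
    have heq : ∀ ω, ∑ j ∈ insert i s, (threeSign (T j ω) : 𝕜) * a j =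
        S ω + (threeSign (T i ω) : 𝕜) * a i := fun ω => by
      rw [Finset.sum_insert hi, add_comm]
    simp_rw [heq]
    have := mul_le_mul_of_nonneg_left hle2 hi2
    rw [Finset.sum_insert hi]
    linarith

end ThreePoint

/-! ### Sparse systems on the unit interval -/

section Sparse

variable {𝕜 ι Ω : Type*} [RCLike 𝕜] [MeasurableSpace Ω]

/-- Orthogonal bounded functions `ξ i` with the moments of a variable that takes the values
`± w i ^ (-2 / (p - 2))` with total probability `w i ^ (2 p / (p - 2))`, and that satisfy
Rosenthal's inequality. The normalization is such that `ξ i` has norm `1` in `L_p` and norm `w i` in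
`L₂`. -/
structure IsSparseSystem (𝕜 : Type*) [RCLike 𝕜] (μ : Measure Ω) (p K : ℝ) (w : ι → ℝ)
    (ξ : ι → Ω → ℝ) : Prop where
  measurable : ∀ i, Measurable (ξ i)
  abs_le : ∀ i ω, |ξ i ω| ≤ w i ^ (-2 / (p - 2))
  integral_mul : ∀ i j, i ≠ j → ∫ ω, ξ i ω * ξ j ω ∂μ = 0
  integral_abs_rpow : ∀ i r, 0 < r → ∫ ω, |ξ i ω| ^ r ∂μ = w i ^ ((2 * p - 2 * r) / (p - 2))
  integral_norm_rpow_le : ∀ (s : Finset ι) (a : ι → 𝕜),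
    ∫ ω, ‖∑ i ∈ s, (ξ i ω : 𝕜) * a i‖ ^ p ∂μ ≤
      (K * ((∑ i ∈ s, ‖a i‖ ^ p) ^ (1 / p) + finL2 s fun i => (w i : 𝕜) * a i)) ^ p

/-- Sparse systems can be transported along measure preserving maps. -/
lemma IsSparseSystem.comp {Ω' : Type*} [MeasurableSpace Ω'] {μ : Measure Ω} {ν : Measure Ω'}
    {p K : ℝ} {w : ι → ℝ} {ξ : ι → Ω → ℝ} (h : IsSparseSystem 𝕜 μ p K w ξ) {φ : Ω' → Ω}
    (hφ : MeasurePreserving φ ν μ) : IsSparseSystem 𝕜 ν p K w fun i x => ξ i (φ x) := by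
  have key : ∀ G : Ω → ℝ, Measurable G → ∫ x, G (φ x) ∂ν = ∫ ω, G ω ∂μ := fun G hG => by
    rw [← hφ.map_eq, integral_map hφ.measurable.aemeasurable hG.aestronglyMeasurable]
  refine ⟨fun i => (h.measurable i).comp hφ.measurable, fun i x => h.abs_le i _,
    fun i j hij => ?_, fun i r hr => ?_, fun s a => ?_⟩
  · rw [key (fun ω => ξ i ω * ξ j ω) ((h.measurable i).mul (h.measurable j))]
    exact h.integral_mul i j hij
  · rw [key (fun ω => |ξ i ω| ^ r) ((h.measurable i).norm.pow_const r)]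
    exact h.integral_abs_rpow i r hr
  · rw [key (fun ω => ‖∑ i ∈ s, (ξ i ω : 𝕜) * a i‖ ^ p)]
    · exact h.integral_norm_rpow_le s a
    · exact ((Finset.measurable_sum _ fun i _ =>
        (RCLike.measurable_ofReal.comp (h.measurable i)).mul_const _).norm).pow_const p

lemma one_le_smoothnessConst {p : ℝ} (hp : 2 < p) : 1 ≤ smoothnessConst p :=
  Real.one_le_exp (by positivity)

theorem exists_isSparseSystem_pi {p : ℝ} (hp : 2 < p) {w : ι → ℝ}
    (hw : ∀ i, 0 < w i ∧ w i ≤ 1) :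
    ∃ ν : Measure (ι → Fin 3), IsProbabilityMeasure ν ∧
      ∃ ξ, IsSparseSystem 𝕜 ν p (4 * smoothnessConst p) w ξ := by
  have hp2 : 0 < p - 2 := by linarith
  have hp0 : 0 < p := by linarith
  let δ : ι → ℝ := fun i => w i ^ (2 * p / (p - 2))
  let c : ι → ℝ := fun i => w i ^ (-2 / (p - 2))
  have hδ0 : ∀ i, 0 ≤ δ i := fun i => Real.rpow_nonneg (hw i).1.le _
  have hδ1 : ∀ i, δ i ≤ 1 := fun i => Real.rpow_le_one (hw i).1.le (hw i).2 (by positivity)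
  have hc0 : ∀ i, 0 < c i := fun i => Real.rpow_pos_of_pos (hw i).1 _
  have hcr : ∀ i r, δ i * c i ^ r = w i ^ ((2 * p - 2 * r) / (p - 2)) := fun i r => by
    simp only [δ, c]
    rw [← Real.rpow_mul (hw i).1.le, ← Real.rpow_add (hw i).1]
    congr 1; ring
  have hcp : ∀ i, δ i * c i ^ p = 1 := fun i => by rw [hcr]; simp
  have hc2 : ∀ i, δ i * c i ^ 2 = w i ^ 2 := fun i => by
    rw [← Real.rpow_natCast, hcr, ← Real.rpow_natCast]
    congr 1; push_cast; rw [div_eq_iff hp2.ne']; ring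
  have := fun i => isProbabilityMeasure_threePoint (hδ0 i) (hδ1 i)
  let ν : Measure (ι → Fin 3) := Measure.infinitePi fun i => threePoint (δ i)
  let T : ι → (ι → Fin 3) → Fin 3 := fun i ω => ω i
  have hT : ∀ i, Measurable (T i) := fun i => measurable_pi_apply i
  have hind : iIndepFun T ν := iIndepFun_infinitePi (X := fun _ v => v) fun _ => measurable_id
  have hlaw : ∀ i, ν.map (T i) = threePoint (δ i) := fun i => Measure.infinitePi_map_eval _ i
  have hint : ∀ i (G : Fin 3 → ℝ), ∫ ω, G (T i ω) ∂ν = (1 - δ i) * G 0 + δ i * ((G 1 + G 2) / 2) :=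
    fun i G => by
      rw [← integral_threePoint (hδ0 i) (hδ1 i), ← hlaw i,
        integral_map (hT i).aemeasurable (measurable_of_finite G).aestronglyMeasurable]
  refine ⟨ν, inferInstance, fun i ω => c i * threeSign (T i ω), fun i => ?_, fun i ω => ?_,
    fun i j hij => ?_, fun i r hr => ?_, fun s a => ?_⟩
  · exact ((measurable_of_finite threeSign).comp (hT i)).const_mul _
  · rw [abs_mul, abs_of_pos (hc0 i)]
    exact mul_le_of_le_one_right (hc0 i).le (abs_threeSign_le _)
  · have h : IndepFun (fun ω => c i * threeSign (T i ω)) (fun ω => c j * threeSign (T j ω)) ν :=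
      (hind.indepFun hij).comp (φ := fun v => c i * threeSign v) (ψ := fun v => c j * threeSign v)
        (measurable_of_finite _) (measurable_of_finite _)
    rw [h.integral_fun_mul_eq_mul_integral
      (((measurable_of_finite threeSign).comp (hT i)).const_mul _).aestronglyMeasurable
      (((measurable_of_finite threeSign).comp (hT j)).const_mul _).aestronglyMeasurable,
      hint i fun v => c i * threeSign v]
    simp [threeSign]
  · rw [hint i fun v => |c i * threeSign v| ^ r]
    simp only [threeSign, Matrix.cons_val_zero, Matrix.cons_val_one, Matrix.cons_val, mul_zero,
      abs_zero, mul_one, mul_neg, abs_neg, abs_of_pos (hc0 i), Real.zero_rpow hr.ne', zero_add]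
    rw [← hcr]; ring
  · set K := smoothnessConst p with hK
    have hK1 : 1 ≤ K := one_le_smoothnessConst hp
    set A := ∑ i ∈ s, ‖a i‖ ^ p with hA
    have hA0 : 0 ≤ A := Finset.sum_nonneg fun _ _ => by positivity
    set N := A ^ (1 / p) + finL2 s fun i => (w i : 𝕜) * a i with hN
    have hσ := finL2_nonneg s fun i => (w i : 𝕜) * a i
    have hA1 : 0 ≤ A ^ (1 / p) := by positivity
    have hN0 : 0 ≤ N := by positivity
    -- If `N = 0`, all coefficients vanish and the scaling below is not available.
    rcases hN0.eq_or_lt with hN0 | hN0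
    · have hz : A ^ (1 / p) = 0 := by linarith
      have hz' : A = 0 := by
        by_contra hne
        exact (Real.rpow_pos_of_pos (lt_of_le_of_ne hA0 (Ne.symm hne)) _).ne' hz
      have ha : ∀ i ∈ s, a i = 0 := fun i hi => by
        have := (Finset.sum_eq_zero_iff_of_nonneg fun _ _ => by positivity).1 hz' i hi
        by_contra hne
        exact (Real.rpow_pos_of_pos (norm_pos_iff.2 hne) p).ne' this
      have hzero : ∀ ω : ι → Fin 3, ∑ i ∈ s, ((c i * threeSign (T i ω) : ℝ) : 𝕜) * a i = 0 :=
        fun ω => Finset.sum_eq_zero fun i hi => by rw [ha i hi, mul_zero]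
      simp_rw [hzero]
      rw [← hN0]
      simp
    · -- After division by `4 * K * N` the coefficients satisfy the smallness conditions of
      -- `integral_norm_sum_rpow_le`.
      set θ : ℝ := 4 * K * N with hθ
      have hθ0 : 0 < θ := by positivity
      let a' : ι → 𝕜 := fun i => ((c i / θ : ℝ) : 𝕜) * a i
      have hna' : ∀ i, ‖a' i‖ = c i / θ * ‖a i‖ := fun i => by
        rw [norm_mul, RCLike.norm_ofReal, abs_of_pos (div_pos (hc0 i) hθ0)]
      have hσN : (∑ i ∈ s, δ i * ‖a' i‖ ^ 2) ≤ (N / θ) ^ 2 := by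
        have h1 : ∑ i ∈ s, δ i * ‖a' i‖ ^ 2 =
            ((finL2 s fun i => (w i : 𝕜) * a i) / θ) ^ 2 := by
          rw [div_pow, finL2_sq, Finset.sum_div]
          refine Finset.sum_congr rfl fun i _ => ?_
          rw [hna', norm_mul, RCLike.norm_ofReal, abs_of_pos (hw i).1, mul_pow, mul_pow, ← hc2,
            div_pow]
          ring
        rw [h1]
        have : (finL2 s fun i => (w i : 𝕜) * a i) ≤ N := by linarith
        gcongr
      have hAN : (∑ i ∈ s, δ i * ‖a' i‖ ^ p) ≤ (N / θ) ^ p := by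
        have h1 : ∑ i ∈ s, δ i * ‖a' i‖ ^ p = A / θ ^ p := by
          rw [hA, Finset.sum_div]
          refine Finset.sum_congr rfl fun i _ => ?_
          have := hc0 i
          rw [hna', Real.mul_rpow (by positivity) (norm_nonneg _), Real.div_rpow (by positivity)
            hθ0.le, ← mul_assoc, ← mul_div_assoc, hcp]
          ring
        rw [h1, Real.div_rpow hN0.le hθ0.le]
        have h2 : A = (A ^ (1 / p)) ^ p := by
          rw [one_div, Real.rpow_inv_rpow hA0 hp0.ne']
        have h3 : A ^ (1 / p) ≤ N := by linarith
        rw [h2]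
        gcongr
      have hNθ : N / θ = 1 / (4 * K) := by rw [hθ]; field_simp
      have hb2 : K * ∑ i ∈ s, δ i * ‖a' i‖ ^ 2 ≤ 1 / 4 := by
        calc _ ≤ K * (N / θ) ^ 2 := by gcongr
          _ = 1 / (16 * K) := by rw [hNθ]; field_simp; norm_num
          _ ≤ 1 / 4 := by
            rw [div_le_div_iff₀ (by positivity) (by norm_num)]; linarith
      have hbp : 2 ^ p * ∑ i ∈ s, δ i * ‖a' i‖ ^ p ≤ 1 / 2 := by
        calc _ ≤ (2 : ℝ) ^ p * (N / θ) ^ p := by gcongr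
          _ = (1 / (2 * K)) ^ p := by
            rw [hNθ, ← Real.mul_rpow (by norm_num) (by positivity)]; congr 1; field_simp; norm_num
          _ ≤ (1 / 2) ^ p := by
            have : 1 / (2 * K) ≤ 1 / 2 := by
              rw [div_le_div_iff₀ (by positivity) (by norm_num)]; linarith
            gcongr
          _ ≤ (1 / 2) ^ (1 : ℝ) :=
            Real.rpow_le_rpow_of_exponent_ge (by norm_num) (by norm_num) (by linarith)
          _ = 1 / 2 := by norm_num
      have hmain := integral_norm_sum_rpow_le (𝕜 := 𝕜) hp hδ0 hδ1 hT hind hlaw a' s hb2 hbp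
      have hle1 : ∫ ω, ‖∑ i ∈ s, (threeSign (T i ω) : 𝕜) * a' i‖ ^ p ∂ν ≤ 1 :=
        hmain.trans (by linarith)
      have hscale : ∀ ω : ι → Fin 3,
          ‖∑ i ∈ s, ((c i * threeSign (T i ω) : ℝ) : 𝕜) * a i‖ ^ p =
            θ ^ p * ‖∑ i ∈ s, (threeSign (T i ω) : 𝕜) * a' i‖ ^ p := fun ω => by
        have h1 : ∑ i ∈ s, ((c i * threeSign (T i ω) : ℝ) : 𝕜) * a i =
            (θ : 𝕜) * ∑ i ∈ s, (threeSign (T i ω) : 𝕜) * a' i := by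
          rw [Finset.mul_sum]
          refine Finset.sum_congr rfl fun i _ => ?_
          have : (θ : 𝕜) ≠ 0 := by exact_mod_cast hθ0.ne'
          simp only [a']
          push_cast
          field_simp
        rw [h1, norm_mul, RCLike.norm_ofReal, abs_of_pos hθ0,
          Real.mul_rpow hθ0.le (norm_nonneg _)]
      simp_rw [hscale]
      rw [integral_const_mul]
      exact mul_le_of_le_one_right (by positivity) hle1

/-- Every probability measure on a standard Borel space is an image of the Lebesgue measure on the
unit interval. -/
lemma exists_measurePreserving_Ioo {Y : Type*} [MeasurableSpace Y] [StandardBorelSpace Y]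
    (ν : Measure Y) [IsProbabilityMeasure ν] :
    ∃ φ : ℝ → Y, MeasurePreserving φ (volume.restrict (Ioo (0 : ℝ) 1)) ν := by
  have : Nonempty Y := ν.nonempty_of_neZero
  obtain ⟨f, hf, hmap⟩ := Measure.exists_measurable_map_eq ν
  have hproj : Measurable (projIcc (0 : ℝ) 1 zero_le_one) := continuous_projIcc.measurable
  refine ⟨fun x => f (projIcc 0 1 zero_le_one x), hf.comp hproj, ?_⟩
  have h1 : MeasurePreserving (Subtype.val : unitInterval → ℝ) volume
      (volume.restrict (Icc (0 : ℝ) 1)) := measurePreserving_subtype_coe measurableSet_Icc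
  change Measure.map (f ∘ projIcc 0 1 zero_le_one) _ = _
  rw [Measure.restrict_congr_set Ioo_ae_eq_Icc, ← h1.map_eq,
    Measure.map_map (hf.comp hproj) h1.measurable, ← hmap]
  congr 1
  ext x
  simp

theorem exists_isSparseSystem [Countable ι] {p : ℝ} (hp : 2 < p) {w : ι → ℝ}
    (hw : ∀ i, 0 < w i ∧ w i ≤ 1) :
    ∃ ξ, IsSparseSystem 𝕜 (volume.restrict (Ioo (0 : ℝ) 1)) p (4 * smoothnessConst p) w ξ := by
  obtain ⟨ν, hν, ξ, hξ⟩ := exists_isSparseSystem_pi (𝕜 := 𝕜) hp hw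
  obtain ⟨φ, hφ⟩ := exists_measurePreserving_Ioo ν
  exact ⟨_, hξ.comp hφ⟩

end Sparse

/-! ### Rosenthal pairs in `L_p` -/

section ToLp

variable {𝕜 ι Ω : Type*} [RCLike 𝕜] [MeasurableSpace Ω] {μ : Measure Ω}

lemma exists_toLp_sum_smul {p : ℝ≥0∞} {h : ι → Ω → 𝕜} (hh : ∀ i, MemLp (h i) p μ) (s : Finset ι)
    (a : ι → 𝕜) : ∃ H : MemLp (fun x => ∑ i ∈ s, h i x * a i) p μ,
      ∑ i ∈ s, a i • (hh i).toLp = H.toLp := by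
  classical
  have H : MemLp (fun x => ∑ i ∈ s, h i x * a i) p μ := memLp_finsetSum _ fun i _ => by
    simpa [mul_comm] using! (hh i).const_mul (a i)
  refine ⟨H, ?_⟩
  induction s using Finset.induction_on with
  | empty =>
    simp only [Finset.sum_empty]
    exact (MemLp.toLp_zero _).symm
  | insert i s hi ih =>
    have H' : MemLp (fun x => ∑ i ∈ s, h i x * a i) p μ := memLp_finsetSum _ fun i _ => by
      simpa [mul_comm] using! (hh i).const_mul (a i)
    rw [Finset.sum_insert hi, ih H', ← MemLp.toLp_const_smul, ← MemLp.toLp_add]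
    congr 1
    ext x
    simp [Finset.sum_insert hi, mul_comm]

lemma norm_toLp_eq_integral {p : ℝ≥0∞} (h0 : p ≠ 0) (htop : p ≠ ∞) {h : Ω → 𝕜}
    (hh : MemLp h p μ) : ‖hh.toLp‖ = (∫ x, ‖h x‖ ^ p.toReal ∂μ) ^ (1 / p.toReal) := by
  rw [Lp.norm_toLp, hh.eLpNorm_eq_integral_rpow_norm h0 htop, one_div, ENNReal.toReal_ofReal]
  exact Real.rpow_nonneg (integral_nonneg fun x => by positivity) _

end ToLp

section SparseLp

variable {𝕜 ι Ω : Type*} [RCLike 𝕜] [MeasurableSpace Ω] {μ : Measure Ω}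
  {p K : ℝ} {w : ι → ℝ} {ξ : ι → Ω → ℝ}

lemma IsSparseSystem.integral_mul_self (hp : 2 < p) (h : IsSparseSystem 𝕜 μ p K w ξ) (i : ι) :
    ∫ ω, ξ i ω * ξ i ω ∂μ = w i ^ 2 := by
  have h1 := h.integral_abs_rpow i 2 two_pos
  have h2 : (2 * p - 2 * 2) / (p - 2) = 2 := by
    rw [div_eq_iff (by linarith)]; ring
  rw [h2, Real.rpow_two] at h1
  rw [← h1]
  refine integral_congr_ae (ae_of_all _ fun ω => ?_)
  simp only [Real.rpow_two, sq_abs]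
  ring

lemma IsSparseSystem.integrable_mul [IsFiniteMeasure μ] (h : IsSparseSystem 𝕜 μ p K w ξ) (i j : ι) :
    Integrable (fun ω => ξ i ω * ξ j ω) μ :=
  Integrable.of_bound ((h.measurable i).mul (h.measurable j)).aestronglyMeasurable
    (w i ^ (-2 / (p - 2)) * w j ^ (-2 / (p - 2))) (ae_of_all _ fun ω => by
      rw [Real.norm_eq_abs, abs_mul]
      exact mul_le_mul (h.abs_le i ω) (h.abs_le j ω) (abs_nonneg _)
        ((abs_nonneg _).trans (h.abs_le i ω)))

/-- Pythagoras' theorem for the orthogonal functions `ξ i`. -/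
lemma IsSparseSystem.integral_norm_sum_sq [IsFiniteMeasure μ] (hp : 2 < p)
    (h : IsSparseSystem 𝕜 μ p K w ξ) (s : Finset ι) (a : ι → 𝕜) :
    ∫ ω, ‖∑ i ∈ s, (ξ i ω : 𝕜) * a i‖ ^ 2 ∂μ = ∑ i ∈ s, w i ^ 2 * ‖a i‖ ^ 2 := by
  classical
  have hexp : ∀ ω, ‖∑ i ∈ s, (ξ i ω : 𝕜) * a i‖ ^ 2 =
      ∑ i ∈ s, ∑ j ∈ s, ξ i ω * ξ j ω * RCLike.re (a i * (starRingEnd 𝕜) (a j)) := by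
    intro ω
    have h1 := RCLike.mul_conj (∑ i ∈ s, (ξ i ω : 𝕜) * a i)
    rw [map_sum, Finset.sum_mul_sum] at h1
    have h2 := congrArg RCLike.re h1
    rw [← RCLike.ofReal_pow, RCLike.ofReal_re] at h2
    rw [← h2, map_sum]
    refine Finset.sum_congr rfl fun i _ => ?_
    rw [map_sum]
    refine Finset.sum_congr rfl fun j _ => ?_
    rw [map_mul (starRingEnd 𝕜), RCLike.conj_ofReal, ← RCLike.re_ofReal_mul]
    congr 1
    push_cast
    ring
  simp_rw [hexp]
  rw [integral_finsetSum _ fun i _ => integrable_finsetSum _ fun j _ =>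
    (h.integrable_mul i j).mul_const _]
  refine Finset.sum_congr rfl fun i hi => ?_
  rw [integral_finsetSum _ fun j _ => (h.integrable_mul i j).mul_const _,
    Finset.sum_eq_single_of_mem i hi fun j _ hj => ?_]
  · rw [integral_mul_const, h.integral_mul_self hp, RCLike.mul_conj, ← RCLike.ofReal_pow,
      RCLike.ofReal_re]
  · rw [integral_mul_const, h.integral_mul i j hj.symm, zero_mul]

/-- For constant weight `1`, Rosenthal's inequality becomes Khintchine's inequality, since the `ℓ_p`
norm is at most the `ℓ₂` norm. -/
lemma IsSparseSystem.isKhintchine (hp : 2 < p) (hK : 0 ≤ K)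
    (h : IsSparseSystem 𝕜 μ p K (fun _ => 1) ξ) : IsKhintchine 𝕜 μ p ((2 * K) ^ p) ξ where
  measurable := h.measurable
  abs_le i ω := by simpa using h.abs_le i ω
  integral_sq i := by simpa using h.integral_mul_self hp i
  integral_mul := h.integral_mul
  integral_norm_rpow_le s c := by
    refine (h.integral_norm_rpow_le s c).trans ?_
    have h0 := finL2_nonneg s c
    have h1 := rpow_sum_rpow_le_finL2 hp s c
    have h2 : 0 ≤ (∑ i ∈ s, ‖c i‖ ^ p) ^ (1 / p) :=
      Real.rpow_nonneg (Finset.sum_nonneg fun _ _ => by positivity) _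
    rw [← Real.mul_rpow (by positivity) h0]
    simp only [RCLike.ofReal_one, one_mul]
    refine Real.rpow_le_rpow (by positivity) ?_ (by linarith)
    nlinarith

end SparseLp

section LpPairs

variable {𝕜 Ω : Type*} [RCLike 𝕜] [MeasurableSpace Ω] {μ : Measure Ω} [IsProbabilityMeasure μ]

/-- The functions `ξ i` in `L_p`, together with `ξ i / w i ^ 2` in `L_q`. The lower estimate holds
because the norm of `L_q` is at most the norm of `L₂`, in which the functions `ξ i / w i` are
orthonormal. -/
theorem isRosenthalPair_lp {p q : ℝ≥0∞} [Fact (1 ≤ p)] [Fact (1 ≤ q)] [p.HolderConjugate q]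
    (hp : 2 < p) (hp_top : p ≠ ∞) {K : ℝ} (hK : 1 ≤ K) {w : ℕ × ℕ → ℝ} {ξ : ℕ × ℕ → Ω → ℝ}
    (hw : ∀ i, 0 < w i) (h : IsSparseSystem 𝕜 μ p.toReal K w ξ) :
    ∃ f g, IsRosenthalPair ((ContinuousLinearMap.mul 𝕜 𝕜).lpPairing μ p q) p.toReal K w f g := by
  have hpr : 2 < p.toReal := by
    simpa using (ENNReal.toReal_lt_toReal (by simp) hp_top).2 hp
  have hpq : p.toReal.HolderConjugate q.toReal := ENNReal.HolderConjugate.toReal (by linarith)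
  have hq1 : 1 < q.toReal := hpq.symm.lt
  have hq0 : q ≠ 0 := by rintro rfl; simp at hq1; linarith
  have hqtop : q ≠ ∞ := by rintro rfl; simp at hq1; linarith
  have hp0 : p ≠ 0 := by rintro rfl; simp at hp
  have hqr : q.toReal = p.toReal / (p.toReal - 1) := hpq.conjugate_eq
  have hq2 : q ≤ 2 := by
    rw [← ENNReal.toReal_le_toReal hqtop (by simp), hqr, div_le_iff₀ (by linarith)]
    simp; linarith
  have hfm : ∀ (r : ℝ≥0∞) i, MemLp (fun ω => (ξ i ω : 𝕜)) r μ := fun r i =>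
    MemLp.of_bound (RCLike.measurable_ofReal.comp (h.measurable i)).aestronglyMeasurable
      (w i ^ (-2 / (p.toReal - 2))) (ae_of_all _ fun ω => by simpa using h.abs_le i ω)
  have hgm : ∀ (r : ℝ≥0∞) i, MemLp (fun ω => (ξ i ω : 𝕜) * ((w i ^ 2)⁻¹ : ℝ)) r μ := fun r i => by
    simpa only [mul_comm] using (hfm r i).const_mul (((w i ^ 2)⁻¹ : ℝ) : 𝕜)
  -- All functions are bounded, so the pairing is an honest integral.
  have hpair : ∀ i j, (ContinuousLinearMap.mul 𝕜 𝕜).lpPairing μ p q (hfm p i).toLp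
      (hgm q j).toLp = (((∫ ω, ξ i ω * ξ j ω ∂μ) * (w j ^ 2)⁻¹ : ℝ) : 𝕜) := fun i j => by
    rw [ContinuousLinearMap.lpPairing_eq_integral, ← integral_mul_const, ← integral_ofReal]
    refine integral_congr_ae ?_
    filter_upwards [(hfm p i).coeFn_toLp, (hgm q j).coeFn_toLp] with ω h1 h2
    rw [h1, h2, ContinuousLinearMap.mul_apply']
    push_cast
    ring
  refine ⟨fun i => (hfm p i).toLp, fun i => (hgm q i).toLp, ?_, ?_, ?_, ?_, ?_⟩
  · intro i
    have := hw i
    rw [hpair, h.integral_mul_self hpr, mul_inv_cancel₀ (by positivity), RCLike.ofReal_one]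
  · intro i j hij
    rw [hpair, h.integral_mul i j hij, zero_mul, RCLike.ofReal_zero]
  · intro i
    have hwi := hw i
    have hone : (∫ ω, ‖(ξ i ω : 𝕜) * ((w i ^ 2)⁻¹ : ℝ)‖ ^ q.toReal ∂μ) = 1 := by
      have h1 : ∀ ω, ‖(ξ i ω : 𝕜) * ((w i ^ 2)⁻¹ : ℝ)‖ ^ q.toReal =
          |ξ i ω| ^ q.toReal * w i ^ (-2 * q.toReal) := fun ω => by
        rw [norm_mul, RCLike.norm_ofReal, RCLike.norm_ofReal,
          abs_of_pos (by positivity : 0 < (w i ^ 2)⁻¹),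
          Real.mul_rpow (abs_nonneg _) (by positivity), Real.rpow_mul hwi.le]
        congr 2
        rw [Real.rpow_neg hwi.le, Real.rpow_two]
      simp_rw [h1]
      rw [integral_mul_const, h.integral_abs_rpow i _ (by linarith), ← Real.rpow_add hwi]
      have h2 : (2 * p.toReal - 2 * q.toReal) / (p.toReal - 2) + -2 * q.toReal = 0 := by
        have hne : p.toReal - 1 ≠ 0 := by linarith
        have hne2 : p.toReal - 2 ≠ 0 := by linarith
        rw [hqr]; field_simp; ring
      rw [h2, Real.rpow_zero]
    rw [norm_toLp_eq_integral hq0 hqtop, hone, Real.one_rpow]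
    exact hK
  · intro s a
    obtain ⟨H, hH⟩ := exists_toLp_sum_smul (hfm p) s a
    have hN : 0 ≤ K * ((∑ i ∈ s, ‖a i‖ ^ p.toReal) ^ (1 / p.toReal) +
        finL2 s fun i => (w i : 𝕜) * a i) := by
      have h0 := finL2_nonneg s fun i => (w i : 𝕜) * a i
      have h1 : 0 ≤ (∑ i ∈ s, ‖a i‖ ^ p.toReal) ^ (1 / p.toReal) :=
        Real.rpow_nonneg (Finset.sum_nonneg fun _ _ => by positivity) _
      positivity
    rw [hH, norm_toLp_eq_integral hp0 hp_top]
    refine (Real.rpow_le_rpow (integral_nonneg fun _ => by positivity)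
      (h.integral_norm_rpow_le s a) (by positivity)).trans (le_of_eq ?_)
    have hpne : p.toReal ≠ 0 := by linarith
    rw [← Real.rpow_mul hN, mul_one_div_cancel hpne, Real.rpow_one]
  · intro s c
    obtain ⟨H, hH⟩ := exists_toLp_sum_smul (hgm q) s fun i => (w i : 𝕜) * c i
    obtain ⟨H2, -⟩ := exists_toLp_sum_smul (hgm 2) s fun i => (w i : 𝕜) * c i
    have hle : ‖H.toLp‖ ≤ ‖H2.toLp‖ := by
      rw [Lp.norm_toLp, Lp.norm_toLp]
      exact ENNReal.toReal_mono H2.eLpNorm_ne_top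
        (eLpNorm_le_eLpNorm_of_exponent_le hq2 H.aestronglyMeasurable)
    rw [hH]
    refine hle.trans ?_
    have heq : ∀ ω, ∑ i ∈ s, (ξ i ω : 𝕜) * ((w i ^ 2)⁻¹ : ℝ) * ((w i : 𝕜) * c i) =
        ∑ i ∈ s, (ξ i ω : 𝕜) * (((w i)⁻¹ : ℝ) * c i) := fun ω => by
      refine Finset.sum_congr rfl fun i _ => ?_
      have : (w i : 𝕜) ≠ 0 := by exact_mod_cast (hw i).ne'
      push_cast
      field_simp
    rw [norm_toLp_eq_integral (by simp) (by simp)]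
    simp only [ENNReal.toReal_ofNat, Real.rpow_two, heq]
    rw [h.integral_norm_sum_sq hpr, ← Real.sqrt_eq_rpow]
    have hfin : ∑ i ∈ s, w i ^ 2 * ‖(((w i)⁻¹ : ℝ) : 𝕜) * c i‖ ^ 2 = ∑ i ∈ s, ‖c i‖ ^ 2 := by
      refine Finset.sum_congr rfl fun i _ => ?_
      have := hw i
      rw [norm_mul, RCLike.norm_ofReal, abs_of_pos (by positivity)]
      field_simp
    rw [hfin]
    exact le_mul_of_one_le_left (finL2_nonneg s c) hK

end LpPairs

/-! ### Closed ideals of `L(L_p(0, 1))` -/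

section Unit

variable {𝕜 : Type*} [RCLike 𝕜]

instance isProbabilityMeasure_restrict_Ioo :
    IsProbabilityMeasure (volume.restrict (Ioo (0 : ℝ) 1)) := ⟨by simp⟩

lemma one_le_four_mul_smoothnessConst {p : ℝ} (hp : 2 < p) : 1 ≤ 4 * smoothnessConst p := by
  have := one_le_smoothnessConst hp
  linarith

lemma exists_isKhintchine {p : ℝ} (hp : 2 < p) : ∃ K, 0 ≤ K ∧ ∃ ε : ℕ × ℕ → ℝ → ℝ,
    IsKhintchine 𝕜 (volume.restrict (Ioo (0 : ℝ) 1)) p K ε := by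
  obtain ⟨ξ, hξ⟩ := exists_isSparseSystem (𝕜 := 𝕜) (ι := ℕ × ℕ) hp (w := fun _ => 1)
    fun _ => ⟨one_pos, le_rfl⟩
  have h0 : 0 ≤ 4 * smoothnessConst p := zero_le_one.trans (one_le_four_mul_smoothnessConst hp)
  exact ⟨_, by positivity, ξ, hξ.isKhintchine hp h0⟩

theorem hasRosenthalPairs_lp {p q : ℝ≥0∞} [Fact (1 ≤ p)] [Fact (1 ≤ q)] [p.HolderConjugate q]
    (hp : 2 < p) (hp_top : p ≠ ∞) :
    HasRosenthalPairs ((ContinuousLinearMap.mul 𝕜 𝕜).lpPairing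
      (volume.restrict (Ioo (0 : ℝ) 1)) p q) p.toReal := by
  intro w hw
  have hpr : 2 < p.toReal := by
    simpa using (ENNReal.toReal_lt_toReal (by simp) hp_top).2 hp
  obtain ⟨ξ, hξ⟩ := exists_isSparseSystem (𝕜 := 𝕜) hpr hw
  exact ⟨_, isRosenthalPair_lp hp hp_top (one_le_four_mul_smoothnessConst hpr)
    (fun i => (hw i).1) hξ⟩

lemma two_lt_of_holderConjugate {p q : ℝ≥0∞} [p.HolderConjugate q] (hp_one : 1 < p) (hp : p < 2) :
    2 < q ∧ q ≠ ∞ := by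
  have hptop : p ≠ ∞ := (hp.trans ENNReal.ofNat_lt_top).ne
  have h1 : 1 < p.toReal := by
    simpa using (ENNReal.toReal_lt_toReal (by simp) hptop).2 hp_one
  have h2 : p.toReal < 2 := by
    simpa using (ENNReal.toReal_lt_toReal hptop (by simp)).2 hp
  have hpq : p.toReal.HolderConjugate q.toReal := ENNReal.HolderConjugate.toReal h1
  have hqtop : q ≠ ∞ := by
    rintro rfl
    have := hpq.symm.lt
    simp at this
    linarith
  refine ⟨?_, hqtop⟩
  rw [← ENNReal.toReal_lt_toReal (by simp) hqtop, hpq.conjugate_eq, lt_div_iff₀ (by linarith)]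
  simp
  linarith

theorem hasManyClosedIdeals_lp (p : ℝ≥0∞) [Fact (1 ≤ p)] (hp_one : 1 < p) (hp_two : p ≠ 2)
    (hp_top : p < ∞) :
    HasManyClosedIdeals 𝕜 (Lp 𝕜 p (volume.restrict (Ioo (0 : ℝ) 1))) := by
  have : Fact (p ≠ ∞) := ⟨hp_top.ne⟩
  let q := ENNReal.conjExponent p
  have hpq : p.HolderConjugate q := inferInstance
  have hq : Fact (1 ≤ q) := ⟨ENNReal.HolderTriple.le q p 1⟩
  rcases hp_two.lt_or_gt with h | h
  · obtain ⟨hq2, hqtop⟩ := two_lt_of_holderConjugate (q := q) hp_one h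
    have hqr : 2 < q.toReal := by
      simpa using (ENNReal.toReal_lt_toReal (by simp) hqtop).2 hq2
    obtain ⟨K, hK, ε, hε⟩ := exists_isKhintchine (𝕜 := 𝕜) hqr
    obtain ⟨J, hJ⟩ := exists_closedIdeals_family_right hqr hε hK
      (hasRosenthalPairs_lp (𝕜 := 𝕜) (p := q) (q := p) hq2 hqtop)
    exact hasManyClosedIdeals_of_orderEmbedding J hJ
  · have hpr : 2 < p.toReal := by
      simpa using (ENNReal.toReal_lt_toReal (by simp) hp_top.ne).2 h
    obtain ⟨K, hK, ε, hε⟩ := exists_isKhintchine (𝕜 := 𝕜) hpr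
    obtain ⟨J, hJ⟩ := exists_closedIdeals_family_left hpr hε hK
      (hasRosenthalPairs_lp (𝕜 := 𝕜) (p := p) (q := q) h hp_top.ne)
    exact hasManyClosedIdeals_of_orderEmbedding J hJ

end Unit

/-! ### The unit vector basis of Rosenthal's space, and separability -/

section Basis

variable (𝕜 : Type*) [RCLike 𝕜] (p : ℝ≥0∞) [Fact (1 ≤ p)] (u : ℕ → ℝ)

/-- The inclusion of Rosenthal's space in the direct sum of `ℓ_p` and `ℓ₂` that defines its norm. -/
noncomputable def rosenthalInclusion :
    RosenthalSpace 𝕜 p u →L[𝕜] lp (fun _ : ℕ => 𝕜) p × lp (fun _ : ℕ => 𝕜) 2 :=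
  (rosenthalSubmodule 𝕜 p u).subtypeL

/-- The unit vectors of Rosenthal's sequence space. -/
noncomputable def rosenthalBasis (i : ℕ) : RosenthalSpace 𝕜 p u :=
  ⟨(lp.single p i 1, lp.single 2 i (u i : 𝕜)), fun j => by
    rcases eq_or_ne j i with rfl | h
    · simp
    · simp [h]⟩

/-- The coordinate functionals of Rosenthal's sequence space. -/
noncomputable def rosenthalCoord (i : ℕ) : StrongDual 𝕜 (RosenthalSpace 𝕜 p u) :=
  lp.evalCLM 𝕜 (fun _ : ℕ => 𝕜) p i ∘L ContinuousLinearMap.fst 𝕜 _ _ ∘L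
    rosenthalInclusion 𝕜 p u

variable {𝕜 p u}

lemma norm_rosenthalInclusion (z : RosenthalSpace 𝕜 p u) : ‖rosenthalInclusion 𝕜 p u z‖ = ‖z‖ := rfl

lemma rosenthalInclusion_fst (z : RosenthalSpace 𝕜 p u) (i : ℕ) :
    (rosenthalInclusion 𝕜 p u z).1 i = rosenthalCoord 𝕜 p u i z := rfl

lemma rosenthalInclusion_snd (z : RosenthalSpace 𝕜 p u) (i : ℕ) :
    (rosenthalInclusion 𝕜 p u z).2 i = (u i : 𝕜) * rosenthalCoord 𝕜 p u i z := z.2 i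

lemma rosenthalInclusion_basis (i : ℕ) : rosenthalInclusion 𝕜 p u (rosenthalBasis 𝕜 p u i) =
    (lp.single p i 1, lp.single 2 i (u i : 𝕜)) := rfl

lemma rosenthalCoord_basis (i j : ℕ) :
    rosenthalCoord 𝕜 p u i (rosenthalBasis 𝕜 p u j) = if i = j then 1 else 0 := by
  rw [← rosenthalInclusion_fst, rosenthalInclusion_basis, lp.single_apply, Pi.single_apply]

lemma rosenthalInclusion_sum (s : Finset ℕ) (c : ℕ → 𝕜) :
    rosenthalInclusion 𝕜 p u (∑ i ∈ s, c i • rosenthalBasis 𝕜 p u i) =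
      (∑ i ∈ s, lp.single p i (c i), ∑ i ∈ s, lp.single 2 i ((u i : 𝕜) * c i)) := by
  rw [map_sum]
  simp only [map_smul, rosenthalInclusion_basis, Prod.smul_mk, ← lp.single_smul, smul_eq_mul,
    mul_one, mul_comm]
  ext1
  · simp [Prod.fst_sum]
  · simp [Prod.snd_sum]

instance : CompleteSpace (RosenthalSpace 𝕜 p u) := by
  have hclosed : IsClosed (rosenthalSubmodule 𝕜 p u :
      Set (lp (fun _ : ℕ => 𝕜) p × lp (fun _ : ℕ => 𝕜) 2)) := by
    have : (rosenthalSubmodule 𝕜 p u : Set (lp (fun _ : ℕ => 𝕜) p × lp (fun _ : ℕ => 𝕜) 2)) =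
        ⋂ j, {x | x.2 j = (u j : 𝕜) * x.1 j} := by
      ext x
      rw [mem_iInter]
      exact Iff.rfl
    rw [this]
    refine isClosed_iInter fun j => isClosed_eq ?_ ?_
    · exact (lp.evalCLM 𝕜 (fun _ : ℕ => 𝕜) 2 j).continuous.comp continuous_snd
    · exact continuous_const.mul
        ((lp.evalCLM 𝕜 (fun _ : ℕ => 𝕜) p j).continuous.comp continuous_fst)
  exact hclosed.completeSpace_coe

lemma norm_sum_smul_basis_le (hp : 1 ≤ p.toReal) {s : Finset ℕ} {c : ℕ → 𝕜} {M : ℝ} (hM : 0 ≤ M)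
    (h1 : ∑ i ∈ s, ‖c i‖ ^ p.toReal ≤ M ^ p.toReal)
    (h2 : ∑ i ∈ s, ‖(u i : 𝕜) * c i‖ ^ 2 ≤ M ^ 2) :
    ‖∑ i ∈ s, c i • rosenthalBasis 𝕜 p u i‖ ≤ M := by
  have hp0 : 0 < p.toReal := by linarith
  rw [← norm_rosenthalInclusion, rosenthalInclusion_sum, Prod.norm_mk, max_le_iff]
  constructor
  · rw [← Real.rpow_le_rpow_iff (norm_nonneg _) hM hp0,
      lp.norm_sum_single (E := fun _ : ℕ => 𝕜) hp0]
    exact h1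
  · have h := lp.norm_sum_single (E := fun _ : ℕ => 𝕜) (p := 2) (by simp)
      (fun i => (u i : 𝕜) * c i) s
    simp only [ENNReal.toReal_ofNat, Real.rpow_two] at h
    refine le_of_sq_le_sq ?_ hM
    rw [h]
    exact h2

lemma sum_norm_coord_rpow_le (hp : 1 ≤ p.toReal) (s : Finset ℕ) (z : RosenthalSpace 𝕜 p u) :
    ∑ i ∈ s, ‖rosenthalCoord 𝕜 p u i z‖ ^ p.toReal ≤ ‖z‖ ^ p.toReal := by
  have hp0 : 0 < p.toReal := by linarith
  have h := lp.sum_rpow_le_norm_rpow hp0 (rosenthalInclusion 𝕜 p u z).1 s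
  refine h.trans (Real.rpow_le_rpow (norm_nonneg _) ?_ hp0.le)
  exact norm_fst_le (rosenthalInclusion 𝕜 p u z)

lemma sum_norm_coord_sq_le (s : Finset ℕ) (z : RosenthalSpace 𝕜 p u) :
    ∑ i ∈ s, ‖(u i : 𝕜) * rosenthalCoord 𝕜 p u i z‖ ^ 2 ≤ ‖z‖ ^ 2 := by
  have h := lp.sum_rpow_le_norm_rpow (p := 2) (by simp) (rosenthalInclusion 𝕜 p u z).2 s
  simp only [ENNReal.toReal_ofNat, Real.rpow_two, rosenthalInclusion_snd] at h
  refine h.trans ?_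
  have := norm_snd_le (rosenthalInclusion 𝕜 p u z)
  rw [norm_rosenthalInclusion] at this
  gcongr

lemma hasSum_coord_smul_basis (hp_top : p ≠ ∞) (z : RosenthalSpace 𝕜 p u) :
    HasSum (fun i => rosenthalCoord 𝕜 p u i z • rosenthalBasis 𝕜 p u i) z := by
  have hind : IsInducing (rosenthalInclusion 𝕜 p u) := IsInducing.subtypeVal
  have h1 := lp.hasSum_single hp_top (rosenthalInclusion 𝕜 p u z).1
  have h2 := lp.hasSum_single (p := 2) (by simp) (rosenthalInclusion 𝕜 p u z).2
  rw [HasSum, hind.tendsto_nhds_iff]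
  refine (h1.prodMk h2).congr fun s => ?_
  rw [Function.comp, rosenthalInclusion_sum]
  simp only [rosenthalInclusion_fst, rosenthalInclusion_snd]
  ext1
  · simp [Prod.fst_sum]
  · simp [Prod.snd_sum]

lemma separableSpace_rosenthalSpace (hp_top : p ≠ ∞) :
    TopologicalSpace.SeparableSpace (RosenthalSpace 𝕜 p u) := by
  have hsep : TopologicalSpace.IsSeparable
      (Submodule.span 𝕜 (range (rosenthalBasis 𝕜 p u)) : Set (RosenthalSpace 𝕜 p u)) :=
    (countable_range _).isSeparable.span
  rw [← TopologicalSpace.isSeparable_univ_iff]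
  refine hsep.closure.mono fun z _ => ?_
  refine mem_closure_of_tendsto (hasSum_coord_smul_basis hp_top z)
    (Eventually.of_forall fun s => ?_)
  exact Submodule.sum_mem _ fun i _ => Submodule.smul_mem _ _ (Submodule.subset_span ⟨i, rfl⟩)

/-- Two vectors of the unit ball with disjoint supports have a sum of norm at most `√2`, and not
merely `2`. -/
lemma norm_add_sum_coord_le_sqrt_two (hp : 2 < p.toReal) {s t : Finset ℕ} (hst : Disjoint s t)
    {x y : RosenthalSpace 𝕜 p u} (hx : ‖x‖ ≤ 1) (hy : ‖y‖ ≤ 1) {a b : 𝕜} (ha : ‖a‖ = 1)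
    (hb : ‖b‖ = 1) :
    ‖a • ∑ i ∈ s, rosenthalCoord 𝕜 p u i x • rosenthalBasis 𝕜 p u i +
      b • ∑ i ∈ t, rosenthalCoord 𝕜 p u i y • rosenthalBasis 𝕜 p u i‖ ≤ √2 := by
  classical
  let c : ℕ → 𝕜 := fun i =>
    if i ∈ s then a * rosenthalCoord 𝕜 p u i x else b * rosenthalCoord 𝕜 p u i y
  have hcs : ∀ i ∈ s, c i = a * rosenthalCoord 𝕜 p u i x := fun i hi => by simp [c, hi]
  have hct : ∀ i ∈ t, c i = b * rosenthalCoord 𝕜 p u i y := fun i hi => by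
    simp [c, Finset.disjoint_right.1 hst hi]
  have hsum : a • ∑ i ∈ s, rosenthalCoord 𝕜 p u i x • rosenthalBasis 𝕜 p u i +
      b • ∑ i ∈ t, rosenthalCoord 𝕜 p u i y • rosenthalBasis 𝕜 p u i =
      ∑ i ∈ s ∪ t, c i • rosenthalBasis 𝕜 p u i := by
    rw [Finset.sum_union hst, Finset.smul_sum, Finset.smul_sum]
    congr 1
    · exact Finset.sum_congr rfl fun i hi => by rw [hcs i hi, smul_smul]
    · exact Finset.sum_congr rfl fun i hi => by rw [hct i hi, smul_smul]
  have hp1 : 1 ≤ p.toReal := by linarith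
  rw [hsum]
  refine norm_sum_smul_basis_le hp1 (Real.sqrt_nonneg 2) ?_ ?_
  · have h1 := sum_norm_coord_rpow_le hp1 s x
    have h2 := sum_norm_coord_rpow_le hp1 t y
    have h3 : ‖x‖ ^ p.toReal ≤ 1 := Real.rpow_le_one (norm_nonneg _) hx (by linarith)
    have h4 : ‖y‖ ^ p.toReal ≤ 1 := Real.rpow_le_one (norm_nonneg _) hy (by linarith)
    have h5 : (2 : ℝ) ≤ √2 ^ p.toReal := by
      calc (2 : ℝ) = √2 ^ (2 : ℝ) := by rw [Real.rpow_two, Real.sq_sqrt (by norm_num)]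
        _ ≤ √2 ^ p.toReal := Real.rpow_le_rpow_of_exponent_le
          (Real.one_le_sqrt.2 (by norm_num)) hp.le
    rw [Finset.sum_union hst,
      Finset.sum_congr rfl fun i hi => by rw [hcs i hi, norm_mul, ha, one_mul],
      Finset.sum_congr (s₁ := t) rfl fun i hi => by rw [hct i hi, norm_mul, hb, one_mul]]
    linarith
  · have h1 := sum_norm_coord_sq_le s x
    have h2 := sum_norm_coord_sq_le t y
    have h3 : ‖x‖ ^ 2 ≤ 1 := pow_le_one₀ (norm_nonneg _) hx
    have h4 : ‖y‖ ^ 2 ≤ 1 := pow_le_one₀ (norm_nonneg _) hy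
    rw [Finset.sum_union hst, Real.sq_sqrt (by norm_num),
      Finset.sum_congr rfl fun i hi => by
        rw [hcs i hi, mul_left_comm, norm_mul, ha, one_mul],
      Finset.sum_congr (s₁ := t) rfl fun i hi => by
        rw [hct i hi, mul_left_comm, norm_mul, hb, one_mul]]
    linarith

/-- The unit vector basis is shrinking: every functional is a norm limit of combinations of
coordinate functionals. -/
lemma exists_norm_sub_sum_coord_lt (hp : 2 < p.toReal) (hp_top : p ≠ ∞)
    (φ : StrongDual 𝕜 (RosenthalSpace 𝕜 p u)) {ε : ℝ} (hε : 0 < ε) :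
    ∃ s : Finset ℕ, ‖φ - ∑ i ∈ s, φ (rosenthalBasis 𝕜 p u i) • rosenthalCoord 𝕜 p u i‖ < ε := by
  classical
  let P : Finset ℕ → RosenthalSpace 𝕜 p u → RosenthalSpace 𝕜 p u := fun s z =>
    ∑ i ∈ s, rosenthalCoord 𝕜 p u i z • rosenthalBasis 𝕜 p u i
  let ψ : Finset ℕ → StrongDual 𝕜 (RosenthalSpace 𝕜 p u) := fun s =>
    φ - ∑ i ∈ s, φ (rosenthalBasis 𝕜 p u i) • rosenthalCoord 𝕜 p u i
  have hψ : ∀ s z, ψ s z = φ z - φ (P s z) := fun s z => by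
    simp only [ψ, P, sub_apply, sum_apply, smul_apply, smul_eq_mul, map_sum,
      map_smul, mul_comm]
  have hψP : ∀ s t, s ⊆ t → ∀ z, ψ s (P t z) = φ (P (t \ s) z) := by
    intro s t hst z
    have h1 : P s (P t z) = P s z := by
      refine Finset.sum_congr rfl fun i hi => ?_
      congr 1
      simp only [P, map_sum, map_smul, rosenthalCoord_basis, smul_eq_mul, mul_ite, mul_one,
        mul_zero, Finset.sum_ite_eq, if_pos (hst hi)]
    have h2 : P t z = P (t \ s) z + P s z := (Finset.sum_sdiff hst).symm
    rw [hψ, h1, h2, map_add, add_sub_cancel_right]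
  have hlim : ∀ s z, Tendsto (fun t => ψ s (P t z)) atTop (𝓝 (ψ s z)) := fun s z =>
    ((ψ s).continuous.tendsto _).comp (hasSum_coord_smul_basis hp_top z)
  -- The infimum `d` of the norms of the tails is zero: a vector nearly norming a nearly optimal
  -- tail, plus a disjoint one nearly norming a later tail, has norm at most `√2` but image
  -- of size nearly `2 * d`.
  set d := ⨅ s, ‖ψ s‖ with hd
  have hbdd : BddBelow (range fun s => ‖ψ s‖) := ⟨0, by rintro _ ⟨s, rfl⟩; exact norm_nonneg _⟩
  have hd0 : 0 ≤ d := le_ciInf fun s => norm_nonneg _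
  have hdle : ∀ s, d ≤ ‖ψ s‖ := fun s => ciInf_le hbdd s
  rcases hd0.eq_or_lt with h | hdpos
  · exact exists_lt_of_ciInf_lt (f := fun s => ‖ψ s‖) (by rw [← hd, ← h]; exact hε)
  exfalso
  obtain ⟨s, hs⟩ := exists_lt_of_ciInf_lt (f := fun s => ‖ψ s‖)
    (show (⨅ s, ‖ψ s‖) < 1.1 * d by rw [← hd]; linarith)
  have hnorming : ∀ r : Finset ℕ, ∃ t, r ⊆ t ∧ ∃ x : RosenthalSpace 𝕜 p u, ‖x‖ ≤ 1 ∧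
      0.9 * d < ‖φ (P (t \ r) x)‖ := by
    intro r
    obtain ⟨x, hx, hlt⟩ := (ψ r).exists_lt_apply_of_lt_opNorm
      (show 0.9 * d < ‖ψ r‖ by have := hdle r; linarith)
    obtain ⟨t, ht, hrt⟩ := (((hlim r x).norm.eventually_const_lt hlt).and
      (eventually_ge_atTop r)).exists
    exact ⟨t, hrt, x, hx.le, by rwa [← hψP r t hrt]⟩
  obtain ⟨t, hst, x, hx, hφx⟩ := hnorming s
  obtain ⟨t', htt', y, hy, hφy⟩ := hnorming t
  obtain ⟨a, ha, ha'⟩ := RCLike.exists_norm_eq_mul_self (φ (P (t \ s) x))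
  obtain ⟨b, hb, hb'⟩ := RCLike.exists_norm_eq_mul_self (φ (P (t' \ t) y))
  have hdisj : Disjoint (t \ s) (t' \ t) :=
    Finset.disjoint_sdiff.mono_left Finset.sdiff_subset
  have hz := norm_add_sum_coord_le_sqrt_two hp hdisj hx hy ha hb
  set z := a • P (t \ s) x + b • P (t' \ t) y with hzdef
  change ‖z‖ ≤ √2 at hz
  have hPzero : ∀ r, Disjoint s r → ∀ v, P s (P r v) = 0 := by
    intro r hr v
    refine Finset.sum_eq_zero fun i hi => ?_
    have : rosenthalCoord 𝕜 p u i (P r v) = 0 := by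
      simp only [P, map_sum, map_smul, rosenthalCoord_basis, smul_eq_mul, mul_ite, mul_one,
        mul_zero, Finset.sum_ite_eq, if_neg (Finset.disjoint_left.1 hr hi)]
    rw [this, zero_smul]
  have hψz : ψ s z = ((‖φ (P (t \ s) x)‖ + ‖φ (P (t' \ t) y)‖ : ℝ) : 𝕜) := by
    rw [hzdef, map_add, map_smul, map_smul, hψ, hψ, hPzero _ Finset.disjoint_sdiff,
      hPzero _ ((Finset.disjoint_sdiff (s := t)).mono_left hst), map_zero, sub_zero, sub_zero,
      smul_eq_mul, smul_eq_mul, ← ha', ← hb', RCLike.ofReal_add]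
  have h1 : ‖φ (P (t \ s) x)‖ + ‖φ (P (t' \ t) y)‖ ≤ 1.1 * d * √2 := by
    have h2 := (ψ s).le_opNorm z
    rw [hψz, RCLike.norm_ofReal, abs_of_nonneg (by positivity)] at h2
    refine h2.trans ?_
    gcongr
  have h3 : √2 < 1.5 := by rw [Real.sqrt_lt' (by norm_num)]; norm_num
  nlinarith

lemma separableSpace_dual_rosenthalSpace (hp : 2 < p.toReal) (hp_top : p ≠ ∞) :
    TopologicalSpace.SeparableSpace (StrongDual 𝕜 (RosenthalSpace 𝕜 p u)) := by
  have hsep : TopologicalSpace.IsSeparable (Submodule.span 𝕜 (range (rosenthalCoord 𝕜 p u)) :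
      Set (StrongDual 𝕜 (RosenthalSpace 𝕜 p u))) :=
    (countable_range _).isSeparable.span
  rw [← TopologicalSpace.isSeparable_univ_iff]
  refine hsep.closure.mono fun φ _ => ?_
  rw [Metric.mem_closure_iff]
  intro ε hε
  obtain ⟨s, hs⟩ := exists_norm_sub_sum_coord_lt hp hp_top φ hε
  refine ⟨_, ?_, by rwa [dist_eq_norm]⟩
  exact Submodule.sum_mem _ fun i _ => Submodule.smul_mem _ _ (Submodule.subset_span ⟨i, rfl⟩)

end Basis

/-! ### Selection of disjoint blocks -/

section Selection

/-- If all terms are at most `t` but their sum is not below `t`, then some partial sum lies between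
`t` and `2 * t`. -/
lemma exists_subset_sum_mem_Icc {ι : Type*} {f : ι → ℝ} {t : ℝ} (ht : 0 ≤ t)
    {A : Finset ι} (hf : ∀ i ∈ A, f i ≤ t) (hA : t ≤ ∑ i ∈ A, f i) :
    ∃ S ⊆ A, t ≤ ∑ i ∈ S, f i ∧ ∑ i ∈ S, f i ≤ 2 * t := by
  classical
  induction A using Finset.induction_on with
  | empty =>
    rw [Finset.sum_empty] at hA
    exact ⟨∅, subset_rfl, by simpa using hA, by simpa using ht⟩
  | insert a A ha ih =>
    rcases le_or_gt t (∑ i ∈ A, f i) with h | h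
    · obtain ⟨S, hS, h1⟩ := ih (fun i hi => hf i (Finset.mem_insert_of_mem hi)) h
      exact ⟨S, hS.trans (Finset.subset_insert _ _), h1⟩
    · refine ⟨insert a A, subset_rfl, hA, ?_⟩
      rw [Finset.sum_insert ha]
      have := hf a (Finset.mem_insert_self _ _)
      linarith

/-- Admissibility of the weight yields, away from any finite set of indices, a block whose sum of
`u i ^ (2 r / (r - 2))` is, up to the factor `2`, a prescribed number. -/
lemma IsRosenthalWeight.exists_block {r : ℝ} (hr : 2 < r) {u : ℕ → ℝ} (hu : IsRosenthalWeight r u)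
    {w : ℝ} (hw : 0 < w) (U : Finset ℕ) : ∃ S : Finset ℕ, Disjoint S U ∧
      w ^ (2 * r / (r - 2)) ≤ ∑ i ∈ S, u i ^ (2 * r / (r - 2)) ∧
      ∑ i ∈ S, u i ^ (2 * r / (r - 2)) ≤ 2 * w ^ (2 * r / (r - 2)) := by
  classical
  set ρ := 2 * r / (r - 2) with hρ
  have hρ0 : 0 < ρ := div_pos (by linarith) (by linarith)
  have hpos : ∀ i, 0 ≤ u i ^ ρ := fun i => Real.rpow_nonneg (hu.1 i).le _
  obtain ⟨s, hs⟩ : ∃ s : Finset {j : ℕ // u j < w},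
      w ^ ρ + ∑ i ∈ U, u i ^ ρ < ∑ j ∈ s, u j ^ ρ := by
    by_contra! h
    exact hu.2 w hw (summable_of_sum_le (fun j => hpos j) h)
  let A : Finset ℕ := s.map (Function.Embedding.subtype _)
  have hA : ∑ i ∈ A, u i ^ ρ = ∑ j ∈ s, u j ^ ρ := Finset.sum_map _ _ _
  have hAU : w ^ ρ ≤ ∑ i ∈ A \ U, u i ^ ρ := by
    have h1 : ∑ i ∈ A, u i ^ ρ ≤ ∑ i ∈ A \ U, u i ^ ρ + ∑ i ∈ U, u i ^ ρ := by
      rw [← Finset.sum_union Finset.sdiff_disjoint]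
      refine Finset.sum_le_sum_of_subset_of_nonneg ?_ fun i _ _ => hpos i
      rw [Finset.sdiff_union_self_eq_union]
      exact Finset.subset_union_left
    linarith
  obtain ⟨S, hSA, h1, h2⟩ := exists_subset_sum_mem_Icc (Real.rpow_nonneg hw.le _) (fun i hi => by
    obtain ⟨j, -, rfl⟩ := Finset.mem_map.1 (Finset.mem_sdiff.1 hi).1
    exact Real.rpow_le_rpow (hu.1 _).le j.2.le hρ0.le) hAU
  refine ⟨S, Finset.disjoint_of_subset_left hSA Finset.sdiff_disjoint, h1, h2⟩

lemma exists_pairwise_disjoint_of_extend {P : ℕ → Finset ℕ → Prop}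
    (h : ∀ m U, ∃ S : Finset ℕ, Disjoint S U ∧ P m S) :
    ∃ S : ℕ → Finset ℕ, (∀ m n, m ≠ n → Disjoint (S m) (S n)) ∧ ∀ m, P m (S m) := by
  choose c hc using h
  let acc : ℕ → Finset ℕ := fun m => Nat.rec ∅ (fun m U => U ∪ c m U) m
  have hmono : Monotone acc := monotone_nat_of_le_succ fun m => Finset.subset_union_left
  have hlt : ∀ m n, m < n → Disjoint (c m (acc m)) (c n (acc n)) := fun m n hmn =>
    ((hc n (acc n)).1.mono_right
      ((Finset.subset_union_right : c m (acc m) ⊆ acc (m + 1)).trans (hmono hmn))).symm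
  refine ⟨fun m => c m (acc m), fun m n hmn => ?_, fun m => (hc m _).2⟩
  rcases hmn.lt_or_gt with h | h
  · exact hlt m n h
  · exact (hlt n m h).symm

/-- Sequences given on disjoint sets can be glued together. -/
lemma exists_eq_on_blocks {κ α M : Type*} [Zero M] {S : κ → Finset α}
    (hS : ∀ m n, m ≠ n → Disjoint (S m) (S n)) (d : κ → α → M) :
    ∃ c : α → M, ∀ m, ∀ i ∈ S m, c i = d m i := by
  classical
  refine ⟨fun i => if h : ∃ m, i ∈ S m then d h.choose i else 0, fun m i hi => ?_⟩
  have h : ∃ m, i ∈ S m := ⟨m, hi⟩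
  have hm : h.choose = m := by
    by_contra hne
    exact Finset.disjoint_left.1 (hS _ _ hne) h.choose_spec hi
  simp only [dif_pos h, hm]

end Selection

/-! ### Rosenthal pairs in Rosenthal's space -/

section Functionals

variable {𝕜 : Type*} [RCLike 𝕜] {p : ℝ≥0∞} [Fact (1 ≤ p)] {u : ℕ → ℝ}

/-- A bound that uses only the `ℓ₂` part of the norm of Rosenthal's space. -/
lemma norm_sum_coord_le_finL2 (s : Finset ℕ) (d : ℕ → 𝕜) :
    ‖∑ i ∈ s, (d i * (u i : 𝕜)) • rosenthalCoord 𝕜 p u i‖ ≤ finL2 s d := by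
  refine ContinuousLinearMap.opNorm_le_bound _ (finL2_nonneg _ _) fun z => ?_
  simp only [sum_apply, smul_apply, smul_eq_mul, mul_assoc]
  calc _ ≤ ∑ i ∈ s, ‖d i‖ * ‖(u i : 𝕜) * rosenthalCoord 𝕜 p u i z‖ := by
        refine (norm_sum_le _ _).trans (Finset.sum_le_sum fun i _ => ?_)
        rw [norm_mul]
    _ ≤ finL2 s d * √(∑ i ∈ s, ‖(u i : 𝕜) * rosenthalCoord 𝕜 p u i z‖ ^ 2) :=
        Real.sum_mul_le_sqrt_mul_sqrt _ _ _
    _ ≤ finL2 s d * ‖z‖ := by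
        refine mul_le_mul_of_nonneg_left ?_ (finL2_nonneg _ _)
        rw [Real.sqrt_le_left (norm_nonneg _)]
        exact sum_norm_coord_sq_le s z

/-- A bound that uses only the `ℓ_p` part of the norm of Rosenthal's space. -/
lemma norm_sum_coord_le_rpow (hp : 1 < p.toReal) {q : ℝ} (hpq : p.toReal.HolderConjugate q)
    (s : Finset ℕ) (d : ℕ → 𝕜) :
    ‖∑ i ∈ s, d i • rosenthalCoord 𝕜 p u i‖ ≤ (∑ i ∈ s, ‖d i‖ ^ q) ^ (1 / q) := by
  have h0 : 0 ≤ (∑ i ∈ s, ‖d i‖ ^ q) ^ (1 / q) :=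
    Real.rpow_nonneg (Finset.sum_nonneg fun _ _ => by positivity) _
  refine ContinuousLinearMap.opNorm_le_bound _ h0 fun z => ?_
  simp only [sum_apply, smul_apply, smul_eq_mul]
  calc _ ≤ ∑ i ∈ s, ‖d i‖ * ‖rosenthalCoord 𝕜 p u i z‖ := by
        refine (norm_sum_le _ _).trans (Finset.sum_le_sum fun i _ => ?_)
        rw [norm_mul]
    _ ≤ (∑ i ∈ s, ‖d i‖ ^ q) ^ (1 / q) *
          (∑ i ∈ s, ‖rosenthalCoord 𝕜 p u i z‖ ^ p.toReal) ^ (1 / p.toReal) :=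
        Real.inner_le_Lp_mul_Lq_of_nonneg _ hpq.symm (fun _ _ => norm_nonneg _)
          fun _ _ => norm_nonneg _
    _ ≤ (∑ i ∈ s, ‖d i‖ ^ q) ^ (1 / q) * ‖z‖ := by
        refine mul_le_mul_of_nonneg_left ?_ h0
        calc _ ≤ (‖z‖ ^ p.toReal) ^ (1 / p.toReal) :=
              Real.rpow_le_rpow (Finset.sum_nonneg fun _ _ => by positivity)
                (sum_norm_coord_rpow_le hp.le s z) (by positivity)
          _ = ‖z‖ := by rw [one_div, Real.rpow_rpow_inv (norm_nonneg _) (by linarith)]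

end Functionals

section RosenthalPairs

variable {𝕜 : Type*} [RCLike 𝕜] {p : ℝ≥0∞} [Fact (1 ≤ p)] {u : ℕ → ℝ}

/-- Let the blocks `S m` of indices be disjoint, with `σ m = ∑ i ∈ S m, u i ^ (2 r / (r - 2))`
comparable to `w m ^ (2 r / (r - 2))`. The vector `∑ i ∈ S m, u i ^ (2 / (r - 2)) e i`, normalized
in `ℓ_r`, has weighted `ℓ₂` norm comparable to `w m`, and the functional that norms it in `ℓ_r` is
also the one that norms it, up to a factor, in the weighted `ℓ₂`. -/
theorem hasRosenthalPairs_rosenthalSpace (hp : 2 < p.toReal)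
    (hu : IsRosenthalWeight p.toReal u) :
    HasRosenthalPairs (NormedSpace.inclusionInDoubleDual 𝕜 (RosenthalSpace 𝕜 p u)) p.toReal := by
  classical
  intro w hw
  set r := p.toReal with hr
  set ρ := 2 * r / (r - 2) with hρ
  have hr2 : 0 < r - 2 := by linarith
  have hr2' : r - 2 ≠ 0 := hr2.ne'
  have hr0 : r ≠ 0 := by linarith
  obtain ⟨S', hS'd, hS'⟩ := exists_pairwise_disjoint_of_extend
    fun m U => hu.exists_block hp (hw (Nat.unpair m)).1 U
  let S : ℕ × ℕ → Finset ℕ := fun m => S' (Nat.pair m.1 m.2)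
  have hSd : ∀ m n, m ≠ n → Disjoint (S m) (S n) := fun m n hmn =>
    hS'd _ _ fun h => hmn (by simpa [Nat.pair_eq_pair, Prod.ext_iff] using h)
  let σ : ℕ × ℕ → ℝ := fun m => ∑ i ∈ S m, u i ^ ρ
  have hσ1 : ∀ m, w m ^ ρ ≤ σ m := fun m => by
    simpa using (hS' (Nat.pair m.1 m.2)).1
  have hσ2 : ∀ m, σ m ≤ 2 * w m ^ ρ := fun m => by
    simpa using (hS' (Nat.pair m.1 m.2)).2
  have hw0 : ∀ m, 0 < w m := fun m => (hw m).1
  have hσ0 : ∀ m, 0 < σ m := fun m => (Real.rpow_pos_of_pos (hw0 m) _).trans_le (hσ1 m)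
  have hu0 : ∀ i, 0 < u i := hu.1
  -- `ρ` is defined so that the weight `σ ^ (1 - 2 / r)` of a block is the square of `σ ^ (1 / ρ)`.
  have hρmul : ρ * (1 - 2 / r) = 2 := by rw [hρ]; field_simp
  have hθ : 0 ≤ 1 - 2 / r := by
    rw [sub_nonneg, div_le_one (by linarith)]; exact hp.le
  have hwρ : ∀ m, (w m ^ ρ) ^ (1 - 2 / r) = w m ^ 2 := fun m => by
    rw [← Real.rpow_mul (hw0 m).le, hρmul, Real.rpow_two]
  have hlow : ∀ m, w m ^ 2 ≤ σ m ^ (1 - 2 / r) := fun m => by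
    rw [← hwρ]
    exact Real.rpow_le_rpow (Real.rpow_nonneg (hw0 m).le _) (hσ1 m) hθ
  have hupp : ∀ m, σ m ^ (1 - 2 / r) ≤ 4 * w m ^ 2 := fun m => by
    calc σ m ^ (1 - 2 / r) ≤ (2 * w m ^ ρ) ^ (1 - 2 / r) :=
          Real.rpow_le_rpow (hσ0 m).le (hσ2 m) hθ
      _ = 2 ^ (1 - 2 / r) * w m ^ 2 := by
          rw [Real.mul_rpow (by norm_num) (Real.rpow_nonneg (hw0 m).le _), hwρ]
      _ ≤ 2 ^ (2 : ℝ) * w m ^ 2 := by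
          have h2r : 0 < 2 / r := by positivity
          have : (2 : ℝ) ^ (1 - 2 / r) ≤ 2 ^ (2 : ℝ) :=
            Real.rpow_le_rpow_of_exponent_le (by norm_num) (by linarith)
          gcongr
      _ = 4 * w m ^ 2 := by rw [Real.rpow_two]; norm_num
  -- Coefficients of the vectors `f m` and functionals `g m`; the products `b m i * a m i` and the
  -- powers `a m i ^ r` both have sum `1` over the block.
  let a : ℕ × ℕ → ℕ → ℝ := fun m i => σ m ^ (-1 / r) * u i ^ (2 / (r - 2))
  let b : ℕ × ℕ → ℕ → ℝ := fun m i => σ m ^ (1 / r - 1) * u i ^ (2 * (r - 1) / (r - 2))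
  have ha0 : ∀ m i, 0 < a m i := fun m i =>
    mul_pos (Real.rpow_pos_of_pos (hσ0 m) _) (Real.rpow_pos_of_pos (hu0 i) _)
  have hb0 : ∀ m i, 0 < b m i := fun m i =>
    mul_pos (Real.rpow_pos_of_pos (hσ0 m) _) (Real.rpow_pos_of_pos (hu0 i) _)
  have hsum1 : ∀ m, ∑ i ∈ S m, (σ m)⁻¹ * u i ^ ρ = 1 := fun m => by
    rw [← Finset.mul_sum]
    exact inv_mul_cancel₀ (hσ0 m).ne'
  have hab : ∀ m i, b m i * a m i = (σ m)⁻¹ * u i ^ ρ := fun m i => by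
    have h1 : σ m ^ (1 / r - 1) * σ m ^ (-1 / r) = (σ m)⁻¹ := by
      rw [← Real.rpow_add (hσ0 m), ← Real.rpow_neg_one]; congr 1; ring
    have h2 : u i ^ (2 * (r - 1) / (r - 2)) * u i ^ (2 / (r - 2)) = u i ^ ρ := by
      rw [← Real.rpow_add (hu0 i), hρ]; congr 1; field_simp; ring
    rw [← h1, ← h2]; ring
  have har : ∀ m i, a m i ^ r = (σ m)⁻¹ * u i ^ ρ := fun m i => by
    rw [Real.mul_rpow (Real.rpow_nonneg (hσ0 m).le _) (Real.rpow_nonneg (hu0 i).le _),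
      ← Real.rpow_mul (hσ0 m).le, ← Real.rpow_mul (hu0 i).le, ← Real.rpow_neg_one]
    congr 2
    · field_simp
    · rw [hρ]; ring
  have ha2 : ∀ m i, (u i * a m i) ^ 2 = σ m ^ (1 - 2 / r) * ((σ m)⁻¹ * u i ^ ρ) := fun m i => by
    have h1 : (σ m ^ (-1 / r)) ^ 2 = σ m ^ (1 - 2 / r) * (σ m)⁻¹ := by
      rw [← Real.rpow_natCast, ← Real.rpow_mul (hσ0 m).le, ← Real.rpow_neg_one,
        ← Real.rpow_add (hσ0 m)]
      congr 1; push_cast; ring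
    have h2 : u i ^ 2 * (u i ^ (2 / (r - 2))) ^ 2 = u i ^ ρ := by
      rw [← Real.rpow_natCast, ← Real.rpow_natCast, ← Real.rpow_mul (hu0 i).le,
        ← Real.rpow_add (hu0 i), hρ]
      congr 1; push_cast; field_simp; ring
    calc (u i * a m i) ^ 2
        = (σ m ^ (-1 / r)) ^ 2 * (u i ^ 2 * (u i ^ (2 / (r - 2))) ^ 2) := by simp only [a]; ring
      _ = _ := by rw [h1, h2]; ring
  have hb2 : ∀ m i, (w m * b m i / u i) ^ 2 =
      w m ^ 2 * (σ m ^ (1 - 2 / r))⁻¹ * ((σ m)⁻¹ * u i ^ ρ) := fun m i => by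
    have h1 : (σ m ^ (1 / r - 1)) ^ 2 = (σ m ^ (1 - 2 / r))⁻¹ * (σ m)⁻¹ := by
      have hinv : (σ m)⁻¹ = σ m ^ (-1 : ℝ) := (Real.rpow_neg_one _).symm
      rw [hinv, ← Real.rpow_natCast, ← Real.rpow_mul (hσ0 m).le,
        ← Real.rpow_neg (hσ0 m).le, ← Real.rpow_add (hσ0 m)]
      congr 1; push_cast; ring
    have h2 : (u i ^ (2 * (r - 1) / (r - 2)) / u i) ^ 2 = u i ^ ρ := by
      rw [← Real.rpow_sub_one (hu0 i).ne', ← Real.rpow_natCast, ← Real.rpow_mul (hu0 i).le, hρ]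
      congr 1; push_cast; field_simp; ring
    calc (w m * b m i / u i) ^ 2
        = w m ^ 2 * (σ m ^ (1 / r - 1)) ^ 2 * (u i ^ (2 * (r - 1) / (r - 2)) / u i) ^ 2 := by
          simp only [b]; ring
      _ = _ := by rw [h1, h2]; ring
  let f : ℕ × ℕ → RosenthalSpace 𝕜 p u := fun m =>
    ∑ i ∈ S m, (a m i : 𝕜) • rosenthalBasis 𝕜 p u i
  let g : ℕ × ℕ → StrongDual 𝕜 (RosenthalSpace 𝕜 p u) := fun m =>
    ∑ i ∈ S m, (b m i : 𝕜) • rosenthalCoord 𝕜 p u i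
  have hcoord : ∀ m i, rosenthalCoord 𝕜 p u i (f m) = if i ∈ S m then (a m i : 𝕜) else 0 := by
    intro m i
    simp only [f, map_sum, map_smul, rosenthalCoord_basis, smul_eq_mul, mul_ite, mul_one, mul_zero,
      Finset.sum_ite_eq]
  have hpairing : ∀ m n, g n (f m) =
      ∑ i ∈ S n, if i ∈ S m then ((b n i * a m i : ℝ) : 𝕜) else 0 := by
    intro m n
    simp only [g]
    rw [sum_apply]
    refine Finset.sum_congr rfl fun i _ => ?_
    rw [smul_apply, hcoord, smul_eq_mul]
    split_ifs
    · push_cast; ring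
    · rw [mul_zero]
  have hdual : ∀ m n, NormedSpace.inclusionInDoubleDual 𝕜 (RosenthalSpace 𝕜 p u) (f m) (g n) =
      g n (f m) := fun _ _ => rfl
  have hpd : ∀ s : Finset (ℕ × ℕ), (s : Set (ℕ × ℕ)).PairwiseDisjoint S :=
    fun s m _ n _ hmn => hSd m n hmn
  refine ⟨2, f, g, fun m => ?_, fun m n hmn => ?_, fun m => ?_, fun s c => ?_, fun s c => ?_⟩
  · rw [hdual, hpairing, Finset.sum_congr rfl fun i hi => if_pos hi, ← RCLike.ofReal_sum]
    simp_rw [hab]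
    rw [hsum1, RCLike.ofReal_one]
  · rw [hdual, hpairing]
    exact Finset.sum_eq_zero fun i hi => if_neg fun h => Finset.disjoint_left.1 (hSd m n hmn) h hi
  · have hpq : r.HolderConjugate (r / (r - 1)) :=
      (Real.holderConjugate_iff_eq_conjExponent (by linarith)).2 rfl
    have hr1 : r - 1 ≠ 0 := by linarith
    refine (norm_sum_coord_le_rpow (by linarith) hpq (S m) fun i => (b m i : 𝕜)).trans ?_
    have hbq : ∀ i, ‖((b m i : ℝ) : 𝕜)‖ ^ (r / (r - 1)) = (σ m)⁻¹ * u i ^ ρ := fun i => by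
      rw [RCLike.norm_ofReal, abs_of_pos (hb0 m i),
        Real.mul_rpow (Real.rpow_nonneg (hσ0 m).le _) (Real.rpow_nonneg (hu0 i).le _),
        ← Real.rpow_mul (hσ0 m).le, ← Real.rpow_mul (hu0 i).le, ← Real.rpow_neg_one]
      congr 2
      · field_simp; ring
      · rw [hρ]; field_simp
    simp_rw [hbq]
    rw [hsum1, Real.one_rpow]
    norm_num
  · obtain ⟨e, he⟩ := exists_eq_on_blocks hSd fun m i => c m * (a m i : 𝕜)
    have hsum : ∑ m ∈ s, c m • f m = ∑ i ∈ s.biUnion S, e i • rosenthalBasis 𝕜 p u i := by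
      rw [Finset.sum_biUnion (hpd s)]
      refine Finset.sum_congr rfl fun m _ => ?_
      rw [Finset.smul_sum]
      exact Finset.sum_congr rfl fun i hi => by rw [he m i hi, smul_smul]
    set X := (∑ m ∈ s, ‖c m‖ ^ r) ^ (1 / r) with hX
    set Y := finL2 s fun m => (w m : 𝕜) * c m with hY
    have hsnn : 0 ≤ ∑ m ∈ s, ‖c m‖ ^ r := Finset.sum_nonneg fun _ _ => by positivity
    have hX0 : 0 ≤ X := Real.rpow_nonneg hsnn _
    have hY0 : 0 ≤ Y := finL2_nonneg _ _
    rw [hsum]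
    refine norm_sum_smul_basis_le (by linarith) (by positivity) ?_ ?_
    · have h1 : ∑ i ∈ s.biUnion S, ‖e i‖ ^ r = X ^ r := by
        rw [hX, one_div, Real.rpow_inv_rpow hsnn hr0, Finset.sum_biUnion (hpd s)]
        refine Finset.sum_congr rfl fun m _ => ?_
        have h2 : ∀ i ∈ S m, ‖e i‖ ^ r = ‖c m‖ ^ r * ((σ m)⁻¹ * u i ^ ρ) := fun i hi => by
          rw [he m i hi, norm_mul, RCLike.norm_ofReal, abs_of_pos (ha0 m i),
            Real.mul_rpow (norm_nonneg _) (ha0 m i).le, har]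
        rw [Finset.sum_congr rfl h2, ← Finset.mul_sum, hsum1, mul_one]
      change ∑ i ∈ s.biUnion S, ‖e i‖ ^ r ≤ _
      rw [h1]
      exact Real.rpow_le_rpow hX0 (by linarith) (by linarith)
    · have h1 : ∑ i ∈ s.biUnion S, ‖(u i : 𝕜) * e i‖ ^ 2 ≤ 4 * Y ^ 2 := by
        rw [hY, finL2_sq, Finset.mul_sum, Finset.sum_biUnion (hpd s)]
        refine Finset.sum_le_sum fun m _ => ?_
        have h2 : ∀ i ∈ S m, ‖(u i : 𝕜) * e i‖ ^ 2 =
            ‖c m‖ ^ 2 * σ m ^ (1 - 2 / r) * ((σ m)⁻¹ * u i ^ ρ) := fun i hi => by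
          rw [he m i hi, mul_left_comm, norm_mul, ← RCLike.ofReal_mul, RCLike.norm_ofReal, mul_pow,
            sq_abs, ha2, mul_assoc]
        rw [Finset.sum_congr rfl h2, ← Finset.mul_sum, hsum1, mul_one, norm_mul,
          RCLike.norm_ofReal, mul_pow, sq_abs]
        have := hupp m
        nlinarith [sq_nonneg ‖c m‖]
      refine h1.trans ?_
      have : 0 ≤ X * Y := mul_nonneg hX0 hY0
      nlinarith [sq_nonneg X]
  · obtain ⟨e, he⟩ := exists_eq_on_blocks hSd fun m i => c m * ((w m * b m i / u i : ℝ) : 𝕜)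
    have hsum : ∑ m ∈ s, ((w m : 𝕜) * c m) • g m =
        ∑ i ∈ s.biUnion S, (e i * (u i : 𝕜)) • rosenthalCoord 𝕜 p u i := by
      rw [Finset.sum_biUnion (hpd s)]
      refine Finset.sum_congr rfl fun m _ => ?_
      rw [Finset.smul_sum]
      refine Finset.sum_congr rfl fun i hi => ?_
      have : (u i : 𝕜) ≠ 0 := by exact_mod_cast (hu0 i).ne'
      rw [he m i hi, smul_smul]
      congr 1
      push_cast
      field_simp
    rw [hsum]
    refine (norm_sum_coord_le_finL2 _ _).trans ?_
    have hle : finL2 (s.biUnion S) e ≤ finL2 s c := by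
      refine Real.sqrt_le_sqrt ?_
      rw [Finset.sum_biUnion (hpd s)]
      refine Finset.sum_le_sum fun m _ => ?_
      have h2 : ∀ i ∈ S m, ‖e i‖ ^ 2 =
          ‖c m‖ ^ 2 * (w m ^ 2 * (σ m ^ (1 - 2 / r))⁻¹) * ((σ m)⁻¹ * u i ^ ρ) := fun i hi => by
        rw [he m i hi, norm_mul, RCLike.norm_ofReal, mul_pow, sq_abs, hb2,
          mul_assoc (‖c m‖ ^ 2)]
      rw [Finset.sum_congr rfl h2, ← Finset.mul_sum, hsum1, mul_one]
      refine mul_le_of_le_one_right (by positivity) ?_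
      rw [← div_eq_mul_inv]
      exact div_le_one_of_le₀ (hlow m) (Real.rpow_nonneg (hσ0 m).le _)
    have h0 := finL2_nonneg s c
    linarith

end RosenthalPairs

/-! ### Closed ideals of the three algebras -/

/-- Rosenthal's space `𝔛_p` is `RosenthalSpace 𝕜 p u` for `2 < p < ∞`, and the dual of
`RosenthalSpace 𝕜 q u` with `1 / p + 1 / q = 1` for `1 < p < 2`; `u` is any admissible weight. -/
theorem theorem1 (𝕜 : Type*) [RCLike 𝕜] (p : ℝ≥0∞) [Fact (1 ≤ p)]
    (hp_one : 1 < p) (hp_two : p ≠ 2) (hp_top : p < ∞) :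
    (2 < p → ∀ u : ℕ → ℝ, IsRosenthalWeight p.toReal u →
      HasManyClosedIdeals 𝕜 (RosenthalSpace 𝕜 p u)) ∧
    (p < 2 → ∀ (q : ℝ≥0∞) [Fact (1 ≤ q)], p.HolderConjugate q →
      ∀ u : ℕ → ℝ, IsRosenthalWeight q.toReal u →
        HasManyClosedIdeals 𝕜 (StrongDual 𝕜 (RosenthalSpace 𝕜 q u))) ∧
    HasManyClosedIdeals 𝕜 (Lp 𝕜 p (volume.restrict (Set.Ioo (0 : ℝ) 1))) := by
  refine ⟨fun hp u hu => ?_, fun hp q _ hpq u hu => ?_,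
    hasManyClosedIdeals_lp p hp_one hp_two hp_top⟩
  · have hpr : 2 < p.toReal := by
      simpa using (ENNReal.toReal_lt_toReal (by simp) hp_top.ne).2 hp
    obtain ⟨K, hK, ε, hε⟩ := exists_isKhintchine (𝕜 := 𝕜) hpr
    obtain ⟨J, hJ⟩ := exists_closedIdeals_family_left hpr hε hK
      (hasRosenthalPairs_rosenthalSpace (𝕜 := 𝕜) hpr hu)
    have := separableSpace_rosenthalSpace (𝕜 := 𝕜) (u := u) hp_top.ne
    exact hasManyClosedIdeals_of_orderEmbedding J hJ
  · obtain ⟨hq2, hqtop⟩ := two_lt_of_holderConjugate (q := q) hp_one hp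
    have hqr : 2 < q.toReal := by
      simpa using (ENNReal.toReal_lt_toReal (by simp) hqtop).2 hq2
    obtain ⟨K, hK, ε, hε⟩ := exists_isKhintchine (𝕜 := 𝕜) hqr
    obtain ⟨J, hJ⟩ := exists_closedIdeals_family_right hqr hε hK
      (hasRosenthalPairs_rosenthalSpace (𝕜 := 𝕜) hqr hu)
    have := separableSpace_dual_rosenthalSpace (𝕜 := 𝕜) (u := u) hqr hqtop
    exact hasManyClosedIdeals_of_orderEmbedding J hJ
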